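/- Let $K$ be an algebraically closed field, $Q$ a finite quiver with vertices $1,\dots,n$, $I$ an admissible ideal of the path algebra $KQ$, and $\Lambda = KQ/I$ with Jacobson radical $J$. Let $\mathbf d = (d_1,\dots,d_n) \in \mathbb N_0^n$. "Module" means finite dimensional left $\Lambda$-module; the dimension vector of $M$ is $\underline{\dim}\, M = (\dim_K e_iM)_{i}$, where $e_i$ is the idempotent of the vertex $i$; $\operatorname{top} M = M/JM$, and $\operatorname{soc} M$ is the sum of the simple submodules of $M$. Let $$\mathbf{Rep}_{\mathbf d}(\Lambda) = \Bigl\{ (x_\alpha)_\alpha \in \prod_{\alpha} \operatorname{Hom}_K\bigl(K^{d_{\mathrm{start}(\alpha)}}, K^{d_{\mathrm{end}(\alpha)}}\bigr) \;\Big|\; \text{the } x_\alpha \text{ satisfy all relations in } I \Bigr\}$$ ($\alpha$ runs over the arrows of $Q$), with its Zariski topology; let $M(x)$ be the $\Lambda$-module on $\bigoplus_i K^{d_i}$ given by $x \in \mathbf{Rep}_{\mathbf d}(\Lambda)$, and for a semisimple module $T$ let $\mathbf{Rep}^T_{\mathbf d} = \{x \in \mathbf{Rep}_{\mathbf d}(\Lambda)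 \mid \operatorname{top} M(x) \cong T\}$. Let $$\mathbf{Top\text{-}Soc}(\mathbf d) = \{(\underline{\dim} \operatorname{top} M, \underline{\dim} \operatorname{soc} M) \mid M \text{ a module with } \underline{\dim}\, M = \mathbf d\},$$ ordered componentwise as a subset of $\mathbb N_0^n \times \mathbb N_0^n$. A semisimple module $T$ is a *generic top* of $\mathbf{Rep}_{\mathbf d}(\Lambda)$ if $\overline{\mathbf{Rep}^T_{\mathbf d}}$ is an irreducible component of $\mathbf{Rep}_{\mathbf d}(\Lambda)$. A semisimple module $U$ is the *generic socle* of the modules in an irreducible subset $\mathcal C \subseteq \mathbf{Rep}_{\mathbf d}(\Lambda)$ if $\operatorname{soc} M(x) \cong U$ for all $x$ in some dense relatively open subset of $\mathcal C$; it is a *generic socle* of $\mathbf{Rep}_{\mathbf d}(\Lambda)$ if this holds for $\mathcal C = \overline{\mathbf{Rep}^T_{\mathbf d}}$ with some generic top $T$ of $\mathbf{Rep}_{\mathbf d}(\Lambda)$. **Corollary 3.7.** Suppose $J^2 = 0$. (1) Let $T$ be a semisimple module. Then the closure of $\mathbf{Rep}^T_{\mathbf d}$ in $\mathbf{Rep}_{\mathbf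 d}(\Lambda)$ is an irreducible component of $\mathbf{Rep}_{\mathbf d}(\Lambda)$ if and only if there is a module $M$ with $\operatorname{top} M \cong T$ and $\underline{\dim}\, M = \mathbf d$ such that the pair $(\underline{\dim} \operatorname{top} M, \underline{\dim} \operatorname{soc} M)$ is minimal in $\mathbf{Top\text{-}Soc}(\mathbf d)$. (2) The set $\mathbf{Top\text{-}Soc}(\mathbf d)$ is finite. If $M_1, \dots, M_m$ are modules with dimension vector $\mathbf d$ such that the pairs $(\underline{\dim} \operatorname{top} M_j, \underline{\dim} \operatorname{soc} M_j)$, $1 \le j \le m$, are the distinct minimal elements of $\mathbf{Top\text{-}Soc}(\mathbf d)$, then $\mathbf{Rep}_{\mathbf d}(\Lambda)$ has precisely $m$ irreducible components, namely the pairwise distinct closures $\mathcal C_j$ of $\mathbf{Rep}^{\operatorname{top} M_j}_{\mathbf d}$, $1 \le j \le m$. Moreover, $\operatorname{soc} M_j$ is the generic socle of the modules in $\mathcal C_j$ for each $j$; up to isomorphism, the generic tops of $\mathbf{Rep}_{\mathbf d}(\Lambda)$ are precisely $\operatorname{top} M_1, \dots, \operatorname{top} M_m$, and the generic socles of $\mathbf{Rep}_{\mathbf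 d}(\Lambda)$ are precisely $\operatorname{soc} M_1, \dots, \operatorname{soc} M_m$. -/

import Mathlib

universe u v w w'

noncomputable section

namespace RadSq

/-! ### Path algebras of quivers, admissible ideals -/

/-- The arrows of a quiver: an arrow `a` starts at `a.1` and ends at `a.2.1`. -/
abbrev Arrow (V : Type v) [Quiver.{w} V] : Type (max v w) := Σ i j : V, (i ⟶ j)

section PathAlgebra

variable (K : Type u) [Field K] (V : Type v) [Fintype V] [Quiver.{w} V]

/-- The defining relations of the path algebra `KQ` on the generators `e_i` (one for each vertex)
and `α` (one for each arrow): the `e_i` are orthogonal idempotents with sum `1`, and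
`e_{end α} α = α = α e_{start α}`.  So products of arrows are composed like functions: `β α` stands
for the path "first `α`, then `β`", and vanishes unless `α` ends where `β` starts. -/
inductive PathRel : FreeAlgebra K (V ⊕ Arrow V) → FreeAlgebra K (V ⊕ Arrow V) → Prop
  | idem (i : V) :
      PathRel (FreeAlgebra.ι K (Sum.inl i) * FreeAlgebra.ι K (Sum.inl i))
        (FreeAlgebra.ι K (Sum.inl i))
  | orth (i j : V) (h : i ≠ j) :
      PathRel (FreeAlgebra.ι K (Sum.inl i) * FreeAlgebra.ι K (Sum.inl j)) 0
  | sum_eq_one : PathRel (∑ i : V, FreeAlgebra.ι K (Sum.inl i)) 1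
  | target (a : Arrow V) :
      PathRel (FreeAlgebra.ι K (Sum.inl a.2.1) * FreeAlgebra.ι K (Sum.inr a))
        (FreeAlgebra.ι K (Sum.inr a))
  | source (a : Arrow V) :
      PathRel (FreeAlgebra.ι K (Sum.inr a) * FreeAlgebra.ι K (Sum.inl a.1))
        (FreeAlgebra.ι K (Sum.inr a))

/-- The path algebra `KQ` of a quiver `Q` with finite vertex set `V`. -/
def PathAlgebra : Type (max u v w) := RingQuot (PathRel K V)

instance : Ring (PathAlgebra K V) := inferInstanceAs (Ring (RingQuot (PathRel K V)))

instance : Algebra K (PathAlgebra K V) := inferInstanceAs (Algebra K (RingQuot (PathRel K V)))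

variable {V}

/-- The idempotent `e_i` of `KQ` (the path of length `0` at the vertex `i`). -/
def vertex (i : V) : PathAlgebra K V :=
  RingQuot.mkAlgHom K (PathRel K V) (FreeAlgebra.ι K (Sum.inl i))

/-- The element of `KQ` given by an arrow. -/
def arrow (a : Arrow V) : PathAlgebra K V :=
  RingQuot.mkAlgHom K (PathRel K V) (FreeAlgebra.ι K (Sum.inr a))

variable (V)

/-- The two-sided ideal of `KQ` generated by the arrows. -/
def arrowIdeal : Ideal (PathAlgebra K V) :=
  Ideal.span {z | ∃ (a : Arrow V) (p q : PathAlgebra K V), z = p * arrow K a * q}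

variable {K V}

/-- A (two-sided) ideal `I` of `KQ` is admissible if `R ^ m ⊆ I ⊆ R ^ 2` for some `m ≥ 2`, where
`R` is the ideal generated by the arrows. -/
def IsAdmissible (I : Ideal (PathAlgebra K V)) : Prop :=
  I ≤ arrowIdeal K V ^ 2 ∧ ∃ m : ℕ, 2 ≤ m ∧ arrowIdeal K V ^ m ≤ I

/-- The algebra `Λ = KQ / I`. -/
abbrev Lam (I : Ideal (PathAlgebra K V)) : Type (max u v w) := PathAlgebra K V ⧸ I

/-- The primitive idempotent of `Λ = KQ / I` belonging to the vertex `i`. -/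
def idem (I : Ideal (PathAlgebra K V)) [I.IsTwoSided] (i : V) : Lam I :=
  Ideal.Quotient.mk I (vertex K i)

end PathAlgebra

/-! ### Modules over `Λ`: dimension vectors, tops and socles -/

section Modules

variable {K : Type u} [Field K] {V : Type v} [Fintype V] [Quiver.{w} V]
variable (I : Ideal (PathAlgebra K V)) [I.IsTwoSided]
variable (M : Type w') [AddCommGroup M] [Module K M] [Module (Lam I) M] [IsScalarTower K (Lam I) M]

/-- The dimension vector `(dim_K e_i M)_i`, meant for finite dimensional `M`. -/
def dimVec : V → ℕ :=
  fun i => Module.finrank K (LinearMap.range (Algebra.lsmul K K M (idem I i)))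

/-- `M` is a finite dimensional module with dimension vector `d`. -/
def HasDimVec (d : V → ℕ) : Prop := Module.Finite K M ∧ dimVec I M = d

/-- The top `M / J M` of a `Λ`-module `M`, where `J` is the Jacobson radical of `Λ`. -/
abbrev top : Type w' := M ⧸ (Ring.jacobson (Lam I) • (⊤ : Submodule (Lam I) M))

/-- The socle of a `Λ`-module `M`: the sum of all simple submodules. -/
def soc : Submodule (Lam I) M := sSup {S : Submodule (Lam I) M | IsSimpleModule (Lam I) S}

/-- The pair `(dim top M, dim soc M)` of dimension vectors. -/
def topSocPair : (V → ℕ) × (V → ℕ) := (dimVec I (top I M), dimVec I (soc I M))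

end Modules

section Varieties

variable {K : Type u} [Field K] {V : Type v} [Fintype V] [Quiver.{w} V]

/-- The set **Top-Soc**(`d`) of all pairs `(dim top M, dim soc M)`, where `M` traces the finite
dimensional `Λ`-modules with dimension vector `d`.  It carries the componentwise order of
`(V → ℕ) × (V → ℕ)`. -/
def TopSoc (I : Ideal (PathAlgebra K V)) [I.IsTwoSided] (d : V → ℕ) :
    Set ((V → ℕ) × (V → ℕ)) :=
  {p | ∃ (M : Type (max u v)) (_ : AddCommGroup M) (_ : Module K M) (_ : Module (Lam I) M)
      (_ : IsScalarTower K (Lam I) M), HasDimVec I M d ∧ topSocPair I M = p}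

/-! ### The affine variety `Rep_d(Λ)` -/

/-- The Zariski topology on the affine space `K ^ σ`: the closed sets are the sets of common zeros
of families of polynomials. -/
@[reducible]
def zariski (K : Type u) [Field K] (σ : Type w') : TopologicalSpace (σ → K) :=
  TopologicalSpace.ofClosed
    {Z | ∃ S : Set (MvPolynomial σ K), Z = {x | ∀ p ∈ S, MvPolynomial.eval x p = 0}}
    ⟨{1}, by ext x; simp⟩
    (by
      intro A hA
      have hA' : ∀ Z : Set (σ → K), ∃ S : Set (MvPolynomial σ K), Z ∈ A →
          Z = {x | ∀ p ∈ S, MvPolynomial.eval x p = 0} := fun Z => by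
        by_cases hZ : Z ∈ A
        · obtain ⟨S, hS⟩ := hA hZ
          exact ⟨S, fun _ => hS⟩
        · exact ⟨∅, fun h => absurd h hZ⟩
      choose S hS using hA'
      refine ⟨⋃ Z ∈ A, S Z, ?_⟩
      ext x
      simp only [Set.mem_sInter, Set.mem_iUnion, Set.mem_ofPred_eq, exists_prop]
      constructor
      · rintro h p ⟨Z, hZ, hp⟩
        have := h Z hZ
        rw [hS Z hZ] at this
        exact this p hp
      · intro h Z hZ
        rw [hS Z hZ]
        exact fun p hp => h p ⟨Z, hZ, hp⟩)
    (by
      rintro A ⟨S, rfl⟩ B ⟨S', rfl⟩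
      refine ⟨{r | ∃ p ∈ S, ∃ q ∈ S', r = p * q}, ?_⟩
      ext x
      simp only [Set.mem_union, Set.mem_ofPred_eq]
      constructor
      · rintro (h | h) r ⟨p, hp, q, hq, rfl⟩
        · rw [map_mul, h p hp, zero_mul]
        · rw [map_mul, h q hq, mul_zero]
      · intro h
        by_contra hc
        push Not at hc
        obtain ⟨⟨p, hp, hp0⟩, q, hq, hq0⟩ := hc
        have := h _ ⟨p, hp, q, hq, rfl⟩
        rw [map_mul] at this
        exact (mul_ne_zero hp0 hq0) this)

variable (K) in
/-- The space `∏_α Hom_K(K ^ {d_{start α}}, K ^ {d_{end α}})` of families of matrices indexed by the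
arrows. -/
abbrev RepSpace (d : V → ℕ) : Type (max u v w) :=
  ∀ a : Arrow V, Matrix (Fin (d a.2.1)) (Fin (d a.1)) K

open Classical in
/-- The action of the generators `e_i` and `α` of `KQ` on `⊕_i K ^ {d_i}` given by the family `x`:
`e_i` is the projection onto the `i`-th summand, and `α` acts as
`x_α : K ^ {d_{start α}} → K ^ {d_{end α}}` on the summand at `start α`, as `0` on the others. -/
def genAction {d : V → ℕ} (x : RepSpace K d) :
    V ⊕ Arrow V → Module.End K (∀ i : V, Fin (d i) → K)
  | Sum.inl i => LinearMap.single K (fun j : V => Fin (d j) → K) i ∘ₗ LinearMap.proj i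
  | Sum.inr a => LinearMap.single K (fun j : V => Fin (d j) → K) a.2.1 ∘ₗ
      Matrix.mulVecLin (x a) ∘ₗ LinearMap.proj a.1

/-- The representation `KQ → End_K(⊕_i K ^ {d_i})` given by a family `x` of matrices. -/
def pathAction {d : V → ℕ} (x : RepSpace K d) :
    PathAlgebra K V →ₐ[K] Module.End K (∀ i : V, Fin (d i) → K) :=
  RingQuot.liftAlgHom K ⟨FreeAlgebra.lift K (genAction x), by
    classical
    intro p q h
    induction h with
    | idem i =>
      simp only [map_mul, FreeAlgebra.lift_ι_apply, genAction]
      refine LinearMap.ext fun m => ?_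
      simp [Module.End.mul_apply]
    | orth i j h =>
      simp only [map_mul, FreeAlgebra.lift_ι_apply, genAction, map_zero]
      refine LinearMap.ext fun m => ?_
      simp [Module.End.mul_apply, Pi.single_eq_of_ne h]
    | sum_eq_one =>
      simp only [map_sum, FreeAlgebra.lift_ι_apply, genAction, map_one]
      refine LinearMap.ext fun m => ?_
      simp [LinearMap.sum_apply, Finset.univ_sum_single]
    | target a =>
      simp only [map_mul, FreeAlgebra.lift_ι_apply, genAction]
      refine LinearMap.ext fun m => ?_
      simp [Module.End.mul_apply]
    | source a =>
      simp only [map_mul, FreeAlgebra.lift_ι_apply, genAction]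
      refine LinearMap.ext fun m => ?_
      simp [Module.End.mul_apply]⟩

variable (I : Ideal (PathAlgebra K V)) [I.IsTwoSided] (d : V → ℕ)

/-- The affine variety `Rep_d(Λ)`, `Λ = KQ / I`: the families `(x_α)` of matrices that satisfy all
relations in `I`. -/
def Rep : Type (max u v w) := {x : RepSpace K d // ∀ r ∈ I, pathAction x r = 0}

/-- The Zariski topology of `Rep_d(Λ)`, as a subset of the affine space of all families of
matrices with the matrix entries as coordinates. -/
instance : TopologicalSpace (Rep I d) :=
  (zariski K (Σ a : Arrow V, Fin (d a.2.1) × Fin (d a.1))).induced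
    fun x c => x.1 c.1 c.2.1 c.2.2

variable {I d}

/-- The `Λ`-module `M(x)` with underlying space `⊕_i K ^ {d_i}`, for a point `x` of `Rep_d(Λ)`. -/
def RepModule (_x : Rep I d) : Type (max u v) := ∀ i : V, Fin (d i) → K

instance (x : Rep I d) : AddCommGroup (RepModule x) :=
  inferInstanceAs (AddCommGroup (∀ i : V, Fin (d i) → K))

instance (x : Rep I d) : Module K (RepModule x) :=
  inferInstanceAs (Module K (∀ i : V, Fin (d i) → K))

/-- The action of `Λ` on `M(x)`. -/
def lamAction (x : Rep I d) : Lam I →+* Module.End K (RepModule x) :=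
  Ideal.Quotient.lift I (pathAction x.1).toRingHom x.2

instance (x : Rep I d) : Module (Lam I) (RepModule x) :=
  Module.compHom (RepModule x) (lamAction x)

instance (x : Rep I d) : IsScalarTower K (Lam I) (RepModule x) where
  smul_assoc c r m := by
    obtain ⟨r, rfl⟩ := Ideal.Quotient.mk_surjective r
    exact LinearMap.congr_fun (map_smul (pathAction x.1) c r) m

variable (I d)

/-- The subvariety `Rep_d^T` of `Rep_d(Λ)`: the points `x` such that `M(x)` has top `T`. -/
def RepTop (T : Type w') [AddCommGroup T] [Module (Lam I) T] : Set (Rep I d) :=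
  {x | Nonempty (top I (RepModule x) ≃ₗ[Lam I] T)}

/-- `T` is a generic top of `Rep_d(Λ)`: the closure of `Rep_d^T` is an irreducible component. -/
def IsGenericTop (T : Type w') [AddCommGroup T] [Module (Lam I) T] : Prop :=
  closure (RepTop I d T) ∈ irreducibleComponents (Rep I d)

variable {I d}

/-- `U` is the generic socle of the modules in the (irreducible) subset `C` of `Rep_d(Λ)`: the
modules `M(x)` have socle `U` for all `x` in some dense (relatively) open subset of `C`. -/
def IsGenericSocleOn (C : Set (Rep I d)) (U : Type w') [AddCommGroup U] [Module (Lam I) U] :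
    Prop :=
  ∃ O : Set (Rep I d), IsOpen O ∧ C ⊆ closure (C ∩ O) ∧
    ∀ x ∈ C ∩ O, Nonempty (soc I (RepModule x) ≃ₗ[Lam I] U)

variable (I d)

/-- `U` is a generic socle of `Rep_d(Λ)`: for some generic top `T` of `Rep_d(Λ)`, it is the generic
socle of the modules in the closure of `Rep_d^T`. -/
def IsGenericSocle (U : Type w') [AddCommGroup U] [Module (Lam I) U] : Prop :=
  ∃ (T : Type (max u v)) (_ : AddCommGroup T) (_ : Module K T) (_ : Module (Lam I) T)
    (_ : IsScalarTower K (Lam I) T), Module.Finite K T ∧ IsSemisimpleModule (Lam I) T ∧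
    IsGenericTop I d T ∧ IsGenericSocleOn (closure (RepTop I d T)) U

end Varieties

end RadSq

end

-- Let R be the arrow ideal of KQ. Since J is the image of R, the condition J² = 0 together with I ≤
-- R² means I = R². So x lies in Rep_d(Λ) if and only if at every vertex i the sum Im_i of the
-- images of the incoming arrows lies in the common kernel Ker_i of the outgoing ones
-- (`mem_rep_iff`). The top of M(x) has dimension vector t(x) = d - dim Im, and the socle has b(x) =
-- dim Ker. Ranks of matrices depending linearly on x are lower semicontinuous, so t and b are upper
-- semicontinuous. Every module with dimension vector d is some M(x) (`exists_equiv_repModule`), and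
-- semisimple modules are determined by their dimension vectors. Hence Top-Soc(d) is the set of
-- values of (t, b), and the sets Rep_d^T are level sets of t.
--
-- For r ≤ d let S_r be the set where r ≤ t and d ≤ r + b. Its points are those admitting subspaces
-- Im_i ≤ W_i ≤ Ker_i of dimension d_i - r_i. It is closed by semicontinuity. It is irreducible if
-- nonempty, being the image of an affine space under a polynomial map: up to a base change, all
-- such points are block matrices with one free block (`isPreirreducible_setOf_finrank`). Every x
-- lies in S_{t(x)}, so finitely many closed irreducible sets S_r cover Rep_d(Λ), and each component
-- is one of them. A nonempty level t = r is relatively open in S_r, so its closure is S_r.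
--
-- The rest is topology (`IsStratified`). On a nonempty S_r both t and b attain their minimum on a
-- common dense open subset. If (t, b)(x) is a minimal pair, the open set of points with pairs below
-- it has constant values and lies in S_{t(x)}, which is therefore a component with generic values
-- (t, b)(x). Conversely, if S_r is a component and the pair of y lies below its generic pair, then
-- S_r ⊆ S_{t(y)}, so equality holds and the generic pair is minimal. Thus components correspond to
-- minimal pairs through their generic values, and the second entry gives the generic socle.

universe w₁ w₂

noncomputable section

namespace RadSq

/-! ### Spaces filtered by a pair of upper semicontinuous functions -/

section Stratification

/-- A pair of upper semicontinuous functions `t, b` with values in `V → ℕ`, such that the sets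
`{x | r ≤ t x ∧ d ≤ r + b x}` are (pre)irreducible and every point `x` lies in the set for
`r = t x`. -/
structure IsStratified {X : Type*} [TopologicalSpace X] {V : Type*} (t b : X → V → ℕ)
    (d : V → ℕ) : Prop where
  isOpen_fst : ∀ i n, IsOpen {x | t x i ≤ n}
  isOpen_snd : ∀ i n, IsOpen {x | b x i ≤ n}
  le : ∀ x, t x ≤ d
  le_add : ∀ x, d ≤ t x + b x
  isPreirreducible : ∀ r, IsPreirreducible {x | r ≤ t x ∧ d ≤ r + b x}

/-- The set `{x | r ≤ t x ∧ d ≤ r + b x}`. -/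
def stratum {X V : Type*} (t b : X → V → ℕ) (d r : V → ℕ) : Set X :=
  {x | r ≤ t x ∧ d ≤ r + b x}

namespace IsStratified

variable {X : Type*} [TopologicalSpace X] {V : Type*} {t b : X → V → ℕ} {d : V → ℕ}

theorem isClosed_stratum (h : IsStratified t b d) (r : V → ℕ) : IsClosed (stratum t b d r) := by
  have : stratum t b d r = (⋂ i, {x | r i ≤ t x i}) ∩ ⋂ i, {x | d i ≤ r i + b x i} := by
    ext x; simp [Pi.le_def, stratum]
  rw [this]
  refine (isClosed_iInter fun i => ?_).inter (isClosed_iInter fun i => ?_)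
  · rcases Nat.eq_zero_or_pos (r i) with h0 | h0
    · simp [h0]
    · have : {x | r i ≤ t x i} = {x | t x i ≤ r i - 1}ᶜ := by
        ext x; simp; omega
      rw [this]
      exact (h.isOpen_fst i _).isClosed_compl
  · rcases Nat.lt_or_ge (r i) (d i) with h0 | h0
    · have : {x | d i ≤ r i + b x i} = {x | b x i ≤ d i - r i - 1}ᶜ := by
        ext x; simp; omega
      rw [this]
      exact (h.isOpen_snd i _).isClosed_compl
    · have : {x | d i ≤ r i + b x i} = Set.univ := by
        ext x; simp; omega
      rw [this]
      exact isClosed_univ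

theorem mem_stratum (h : IsStratified t b d) (x : X) : x ∈ stratum t b d (t x) :=
  ⟨le_rfl, h.le_add x⟩

theorem level_subset_stratum (h : IsStratified t b d) (r : V → ℕ) :
    {x | t x = r} ⊆ stratum t b d r := by
  rintro x rfl
  exact h.mem_stratum x

variable [Finite V]

theorem isOpen_fst_le (h : IsStratified t b d) (r : V → ℕ) : IsOpen {x | t x ≤ r} := by
  have : {x | t x ≤ r} = ⋂ i, {x | t x i ≤ r i} := by ext x; simp [Pi.le_def]
  rw [this]
  exact isOpen_iInter_of_finite fun i => h.isOpen_fst i _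

theorem isOpen_snd_le (h : IsStratified t b d) (r : V → ℕ) : IsOpen {x | b x ≤ r} := by
  have : {x | b x ≤ r} = ⋂ i, {x | b x i ≤ r i} := by ext x; simp [Pi.le_def]
  rw [this]
  exact isOpen_iInter_of_finite fun i => h.isOpen_snd i _

theorem isOpen_pair_le (h : IsStratified t b d) (p : (V → ℕ) × (V → ℕ)) :
    IsOpen {x | (t x, b x) ≤ p} :=
  (h.isOpen_fst_le p.1).inter (h.isOpen_snd_le p.2)

/-- Within the stratum, where r ≤ t, the level is cut out by the open condition t ≤ r; a nonempty
open part of an irreducible set is dense. -/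
theorem closure_level (h : IsStratified t b d) {r : V → ℕ} (hr : {x | t x = r}.Nonempty) :
    closure {x | t x = r} = stratum t b d r := by
  refine (closure_minimal (h.level_subset_stratum r) (h.isClosed_stratum r)).antisymm ?_
  obtain ⟨x, hx⟩ := hr
  have := subset_closure_inter_of_isPreirreducible_of_isOpen (h.isPreirreducible r) (h.isOpen_fst_le r)
    ⟨x, h.level_subset_stratum r hx, hx.le⟩
  exact this.trans (closure_mono fun y hy => le_antisymm hy.2 hy.1.1)

/-- A nonempty stratum contains points at which both functions are minimal. -/
theorem exists_generic (h : IsStratified t b d) {r : V → ℕ} (hr : (stratum t b d r).Nonempty) :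
    ∃ x ∈ stratum t b d r, ∀ y ∈ stratum t b d r, (t x, b x) ≤ (t y, b y) := by
  have : WellFounded ((· < ·) : (V → ℕ) × (V → ℕ) → (V → ℕ) × (V → ℕ) → Prop) :=
    wellFounded_lt
  obtain ⟨p, ⟨x, hx, rfl⟩, hmin⟩ := this.has_min ((fun x => (t x, b x)) '' stratum t b d r)
    (hr.image _)
  refine ⟨x, hx, fun y hy => ?_⟩
  -- Two nonempty open parts of an irreducible set meet. The common point z lies below both x and y,
  -- and minimality of x forces z to have the values of x.
  obtain ⟨z, hz, hzx, hzy⟩ := h.isPreirreducible r _ _ (h.isOpen_pair_le (t x, b x))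
    (h.isOpen_pair_le (t y, b y)) ⟨x, hx, le_refl (t x, b x)⟩ ⟨y, hy, le_refl (t y, b y)⟩
  rcases (show (t z, b z) ≤ (t x, b x) from hzx).lt_or_eq with hlt | heq
  · exact absurd hlt (hmin _ ⟨z, hz, rfl⟩)
  · exact heq ▸ hzy

/-- If `x` is generic in a stratum, the points with the same values as `x` are dense in it. -/
theorem stratum_subset_closure (h : IsStratified t b d) {r : V → ℕ} {x : X}
    (hx : x ∈ stratum t b d r) :
    stratum t b d r ⊆ closure (stratum t b d r ∩ {y | (t y, b y) ≤ (t x, b x)}) :=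
  subset_closure_inter_of_isPreirreducible_of_isOpen (h.isPreirreducible r) (h.isOpen_pair_le _) ⟨x, hx, le_refl (t x, b x)⟩

/-- By minimality, points with values below those of x have the same values, hence lie in the
stratum of x. They form an open set, so they are dense in any irreducible set containing that
stratum, which is therefore no larger. -/
theorem stratum_mem_irreducibleComponents (h : IsStratified t b d) {x : X}
    (hx : Minimal (· ∈ Set.range fun y => (t y, b y)) (t x, b x)) :
    stratum t b d (t x) ∈ irreducibleComponents X := by
  refine ⟨⟨⟨x, h.mem_stratum x⟩, h.isPreirreducible _⟩, fun C hC hSC => ?_⟩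
  have := subset_closure_inter_of_isPreirreducible_of_isOpen hC.isPreirreducible (h.isOpen_pair_le (t x, b x))
    ⟨x, hSC (h.mem_stratum x), le_refl (t x, b x)⟩
  refine this.trans (closure_minimal ?_ (h.isClosed_stratum _))
  rintro y ⟨-, hy⟩
  have := (Prod.mk.inj (hx.eq_of_le ⟨y, rfl⟩ hy)).1
  rw [← this]
  exact h.mem_stratum y

theorem closure_level_mem_irreducibleComponents (h : IsStratified t b d) {x : X}
    (hx : Minimal (· ∈ Set.range fun y => (t y, b y)) (t x, b x)) :
    closure {y | t y = t x} ∈ irreducibleComponents X := by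
  rw [h.closure_level ⟨x, rfl⟩]
  exact h.stratum_mem_irreducibleComponents hx

/-- A stratum which is an irreducible component belongs to a minimal pair of values. -/
theorem exists_minimal_of_stratum (h : IsStratified t b d) {r : V → ℕ}
    (hr : stratum t b d r ∈ irreducibleComponents X) :
    ∃ x ∈ stratum t b d r, (∀ y ∈ stratum t b d r, (t x, b x) ≤ (t y, b y)) ∧
      Minimal (· ∈ Set.range fun y => (t y, b y)) (t x, b x) ∧
      stratum t b d (t x) = stratum t b d r := by
  obtain ⟨x, hx, hgen⟩ := h.exists_generic hr.1.nonempty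
  -- The generic points of the stratum of r also lie in the stratum of any y below x; density and
  -- maximality make the two strata equal.
  have key : ∀ y, (t y, b y) ≤ (t x, b x) → stratum t b d (t y) = stratum t b d r := by
    intro y hy
    have hsub : stratum t b d r ⊆ stratum t b d (t y) := by
      refine (h.stratum_subset_closure hx).trans (closure_minimal ?_ (h.isClosed_stratum _))
      rintro z ⟨hz, hzx⟩
      have hxz : (t x, b x) ≤ (t z, b z) := hgen z hz
      exact ⟨hy.1.trans hxz.1, fun i => (h.le_add y i).trans
        (Nat.add_le_add_left ((hy.2.trans hxz.2) i) _)⟩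
    exact (hr.2 ⟨⟨y, h.mem_stratum y⟩, h.isPreirreducible _⟩ hsub).antisymm hsub
  refine ⟨x, hx, hgen, ⟨⟨x, rfl⟩, ?_⟩, key x le_rfl⟩
  rintro _ ⟨y, rfl⟩ hy
  exact hgen y (key y hy ▸ h.mem_stratum y)

theorem closure_level_mem_irreducibleComponents_iff (h : IsStratified t b d) {r : V → ℕ} :
    closure {x | t x = r} ∈ irreducibleComponents X ↔
      ∃ x, t x = r ∧ Minimal (· ∈ Set.range fun y => (t y, b y)) (t x, b x) := by
  constructor
  · intro hr
    have hne : {x | t x = r}.Nonempty := closure_nonempty_iff.mp hr.1.nonempty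
    rw [h.closure_level hne] at hr
    obtain ⟨x, hx, hgen, hmin, -⟩ := h.exists_minimal_of_stratum hr
    obtain ⟨y, rfl⟩ := hne
    -- The nonempty level supplies y with t y = r, and the generic x has t x ≤ t y; this excludes t
    -- x > r.
    exact ⟨x, le_antisymm (hgen y (h.mem_stratum y)).1 hx.1, hmin⟩
  · rintro ⟨x, rfl, hx⟩
    exact h.closure_level_mem_irreducibleComponents hx

/-- Since t ≤ d, only the finitely many closed strata with r ≤ d are needed to cover the space, and
an irreducible set lies in one member of a finite closed cover. -/
theorem exists_minimal_of_mem_irreducibleComponents (h : IsStratified t b d) {C : Set X}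
    (hC : C ∈ irreducibleComponents X) :
    ∃ x, Minimal (· ∈ Set.range fun y => (t y, b y)) (t x, b x) ∧ C = closure {y | t y = t x} := by
  classical
  cases nonempty_fintype V
  obtain ⟨S, hS, hCS⟩ := isIrreducible_iff_sUnion_isClosed.mp hC.1
    ((Finset.Icc 0 d).image (stratum t b d))
    (by simpa using fun r _ => h.isClosed_stratum r)
    (fun x _ => Set.mem_sUnion.mpr ⟨_, by simpa using ⟨t x, h.le x, rfl⟩, h.mem_stratum x⟩)
  obtain ⟨r, -, rfl⟩ := Finset.mem_image.mp hS
  have hCr : C = stratum t b d r :=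
    hCS.antisymm (hC.2 ⟨hC.1.nonempty.mono hCS, h.isPreirreducible r⟩ hCS)
  subst hCr
  obtain ⟨x, -, -, hmin, hxr⟩ := h.exists_minimal_of_stratum hC
  exact ⟨x, hmin, by rw [h.closure_level ⟨x, rfl⟩, hxr]⟩

/-- Points with minimal pairs of values that define the same component have the same values. -/
theorem eq_of_closure_level_eq (h : IsStratified t b d) {x y : X}
    (hx : Minimal (· ∈ Set.range fun y => (t y, b y)) (t x, b x))
    (hy : Minimal (· ∈ Set.range fun y => (t y, b y)) (t y, b y))
    (hxy : closure {z | t z = t x} = closure {z | t z = t y}) : (t x, b x) = (t y, b y) := by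
  rw [h.closure_level ⟨x, rfl⟩, h.closure_level ⟨y, rfl⟩] at hxy
  -- A generic point z of the common stratum lies below both x and y, so by minimality it has the
  -- values of each.
  obtain ⟨z, hz, hgen⟩ := h.exists_generic ⟨x, h.mem_stratum x⟩
  rw [hx.eq_of_ge ⟨z, rfl⟩ (hgen x (h.mem_stratum x)),
    hy.eq_of_ge ⟨z, rfl⟩ (hgen y (hxy ▸ h.mem_stratum y))]

/-- The second function is constant on a dense open subset of the component of a minimal pair. -/
theorem exists_isOpen_snd_eq (h : IsStratified t b d) {x : X}
    (hx : Minimal (· ∈ Set.range fun y => (t y, b y)) (t x, b x)) :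
    ∃ O : Set X, IsOpen O ∧ closure {y | t y = t x} ⊆ closure (closure {y | t y = t x} ∩ O) ∧
      ∀ y ∈ O, b y = b x := by
  refine ⟨{y | (t y, b y) ≤ (t x, b x)}, h.isOpen_pair_le _, ?_, fun y hy =>
    (Prod.mk.inj (hx.eq_of_le ⟨y, rfl⟩ hy)).2⟩
  rw [h.closure_level ⟨x, rfl⟩]
  exact h.stratum_subset_closure (h.mem_stratum x)

end IsStratified

end Stratification

/-! ### The algebra `KQ / I` and its Jacobson radical -/

section Algebra

variable {K : Type u} [Field K] {V : Type v} [Fintype V] [Quiver.{w} V]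

variable (K V) in
/-- The quotient map from the free algebra to the path algebra. -/
def PathAlgebra.mk : FreeAlgebra K (V ⊕ Arrow V) →ₐ[K] PathAlgebra K V :=
  RingQuot.mkAlgHom K (PathRel K V)

theorem PathAlgebra.mk_rel {p q : FreeAlgebra K (V ⊕ Arrow V)} (h : PathRel K V p q) :
    PathAlgebra.mk K V p = PathAlgebra.mk K V q :=
  RingQuot.mkAlgHom_rel K h

theorem vertex_eq (i : V) : vertex K i = PathAlgebra.mk K V (FreeAlgebra.ι K (Sum.inl i)) := rfl

theorem arrow_eq (a : Arrow V) : arrow K a = PathAlgebra.mk K V (FreeAlgebra.ι K (Sum.inr a)) := rfl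

theorem PathAlgebra.induction {P : PathAlgebra K V → Prop}
    (algebraMap : ∀ c : K, P (algebraMap K _ c)) (vertex : ∀ i, P (vertex K i))
    (arrow : ∀ a, P (arrow K a)) (add : ∀ x y, P x → P y → P (x + y))
    (mul : ∀ x y, P x → P y → P (x * y)) (z : PathAlgebra K V) : P z := by
  obtain ⟨f, rfl⟩ := RingQuot.mkAlgHom_surjective K (PathRel K V) z
  induction f using FreeAlgebra.induction with
  | grade0 c => rw [AlgHom.commutes]; exact algebraMap c
  | grade1 s =>
    rcases s with i | a
    · exact vertex i
    · exact arrow a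
  | mul x y hx hy => rw [map_mul]; exact mul _ _ hx hy
  | add x y hx hy => rw [map_add]; exact add _ _ hx hy

theorem vertex_mul_self (i : V) : vertex K i * vertex K i = vertex K i := by
  rw [vertex_eq, ← map_mul, PathAlgebra.mk_rel (PathRel.idem i)]

theorem vertex_mul_of_ne {i j : V} (h : i ≠ j) : vertex K i * vertex K j = 0 := by
  rw [vertex_eq, vertex_eq, ← map_mul, PathAlgebra.mk_rel (PathRel.orth i j h), map_zero]

theorem sum_vertex : ∑ i : V, vertex K i = 1 := by
  simp only [vertex_eq, ← map_sum]
  rw [PathAlgebra.mk_rel PathRel.sum_eq_one, map_one]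

theorem vertex_mul_arrow (a : Arrow V) : vertex K a.2.1 * arrow K a = arrow K a := by
  rw [vertex_eq, arrow_eq, ← map_mul, PathAlgebra.mk_rel (PathRel.target a)]

theorem arrow_mul_vertex (a : Arrow V) : arrow K a * vertex K a.1 = arrow K a := by
  rw [vertex_eq, arrow_eq, ← map_mul, PathAlgebra.mk_rel (PathRel.source a)]

theorem arrow_mul_vertex_of_ne {i : V} {a : Arrow V} (h : a.1 ≠ i) :
    arrow K a * vertex K i = 0 := by
  rw [← arrow_mul_vertex, mul_assoc, vertex_mul_of_ne h, mul_zero]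

theorem arrow_mem_arrowIdeal (a : Arrow V) : arrow K a ∈ arrowIdeal K V :=
  Ideal.subset_span ⟨a, 1, 1, by simp⟩

instance : (arrowIdeal K V).IsTwoSided where
  mul_mem_of_left {z} b hz := by
    induction hz using Submodule.span_induction with
    | mem z hz =>
      obtain ⟨a, p, q, rfl⟩ := hz
      exact Ideal.subset_span ⟨a, p, q * b, by simp only [mul_assoc]⟩
    | zero => rw [zero_mul]; exact zero_mem _
    | add x y _ _ hx hy => rw [add_mul]; exact add_mem hx hy
    | smul r x _ hx => rw [smul_eq_mul, mul_assoc]; exact Ideal.mul_mem_left _ _ hx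

/-- Every element of `KQ` is a linear combination of the vertices, up to the arrow ideal. -/
theorem exists_sub_sum_vertex_mem (z : PathAlgebra K V) :
    ∃ c : V → K, z - ∑ i, c i • vertex K i ∈ arrowIdeal K V := by
  classical
  induction z using PathAlgebra.induction with
  | algebraMap c =>
    refine ⟨fun _ => c, ?_⟩
    rw [← Finset.smul_sum, sum_vertex, Algebra.algebraMap_eq_smul_one, sub_self]
    exact zero_mem _
  | vertex i =>
    refine ⟨Pi.single i 1, ?_⟩
    simp [Pi.single_apply, ite_smul]
  | arrow a => exact ⟨0, by simpa using arrow_mem_arrowIdeal a⟩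
  | add x y hx hy =>
    obtain ⟨c, hc⟩ := hx
    obtain ⟨e, he⟩ := hy
    refine ⟨c + e, ?_⟩
    convert add_mem hc he using 1
    simp only [Pi.add_apply, add_smul, Finset.sum_add_distrib]
    abel
  | mul x y hx hy =>
    obtain ⟨c, hc⟩ := hx
    obtain ⟨e, he⟩ := hy
    refine ⟨c * e, ?_⟩
    have : (∑ i, c i • vertex K i) * ∑ i, e i • vertex K i = ∑ i, (c * e) i • vertex K i := by
      rw [Finset.sum_mul]
      refine Finset.sum_congr rfl fun i _ => ?_
      rw [Finset.mul_sum, Finset.sum_eq_single i]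
      · rw [smul_mul_smul_comm, vertex_mul_self, Pi.mul_apply]
      · intro j _ hj
        rw [smul_mul_smul_comm, vertex_mul_of_ne hj.symm, smul_zero]
      · simp
    rw [← this]
    convert add_mem ((arrowIdeal K V).mul_mem_right y hc)
      ((arrowIdeal K V).mul_mem_left (∑ i, c i • vertex K i) he) using 1
    rw [sub_mul, mul_sub]
    abel

open Classical in
/-- The character of `KQ` that maps the vertex `i` to `1`, the other vertices and the arrows
to `0`. -/
def character (i : V) : PathAlgebra K V →ₐ[K] K :=
  RingQuot.liftAlgHom K ⟨FreeAlgebra.lift K (Sum.elim (fun j => if j = i then 1 else 0) 0), by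
    intro p q h
    induction h with
    | idem j => by_cases h : j = i <;> simp [h]
    | orth j k h =>
      by_cases hj : j = i
      · subst hj; simp [h.symm]
      · simp [hj]
    | sum_eq_one => simp
    | target a => simp
    | source a => simp⟩

open Classical in
theorem character_vertex (i j : V) :
    character i (vertex K j) = if j = i then 1 else 0 :=
  (RingQuot.liftAlgHom_mkAlgHom_apply K _ _ _).trans (by simp)

theorem character_arrow (i : V) (a : Arrow V) : character i (arrow K a) = 0 :=
  (RingQuot.liftAlgHom_mkAlgHom_apply K _ _ _).trans (by simp)

theorem character_eq_zero_of_mem {z : PathAlgebra K V} (hz : z ∈ arrowIdeal K V) (i : V) :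
    character i z = 0 := by
  have : arrowIdeal K V ≤ RingHom.ker (character (K := K) i) := by
    refine Ideal.span_le.mpr ?_
    rintro _ ⟨a, p, q, rfl⟩
    simp [RingHom.mem_ker, character_arrow]
  exact this hz

/-- Modulo the arrow ideal an element is a combination of vertices, and the characters read off its
coefficients. -/
theorem mem_arrowIdeal_of_character {z : PathAlgebra K V} (hz : ∀ i, character i z = 0) :
    z ∈ arrowIdeal K V := by
  classical
  obtain ⟨c, hc⟩ := exists_sub_sum_vertex_mem z
  have h0 : c = 0 := by
    funext i
    have := character_eq_zero_of_mem hc i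
    simpa [hz i, character_vertex] using this
  simpa [h0] using hc

variable {I : Ideal (PathAlgebra K V)}

theorem IsAdmissible.le_arrowIdeal (hI : IsAdmissible I) : I ≤ arrowIdeal K V :=
  hI.1.trans (Ideal.pow_le_self two_ne_zero)

variable [I.IsTwoSided]

/-- The Jacobson radical of `KQ / I` is the image of the arrow ideal. -/
theorem mk_mem_jacobson_iff (hI : IsAdmissible I) {z : PathAlgebra K V} :
    Ideal.Quotient.mk I z ∈ Ring.jacobson (Lam I) ↔ z ∈ arrowIdeal K V := by
  rw [Ring.jacobson_eq_sInf_isMaximal, Ideal.mem_sInf]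
  constructor
  · intro h
    refine mem_arrowIdeal_of_character fun i => ?_
    -- The kernel of a character is a maximal left ideal, so it contains the radical.
    let χ : Lam I →+* K := Ideal.Quotient.lift I (character (K := K) i).toRingHom
      fun a ha => character_eq_zero_of_mem (hI.le_arrowIdeal ha) i
    have hχ : Function.Surjective χ := fun c =>
      ⟨Ideal.Quotient.mk I (algebraMap K _ c), by
        change character i (algebraMap K _ c) = c
        exact AlgHom.commutes _ _⟩
    exact h (RingHom.ker_isMaximal_of_surjective χ hχ)
  · intro hz N hN
    -- If a maximal left ideal N missed z, then 1 - y z would lie in N for some y. But y z is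
    -- nilpotent modulo I, because a power of the arrow ideal lies in I, so 1 - y z is a unit.
    by_contra hzN
    have htop := (Ideal.isMaximal_def.mp hN).2 (N ⊔ Ideal.span {Ideal.Quotient.mk I z})
      (left_lt_sup.mpr fun h => hzN (h (Ideal.mem_span_singleton_self _)))
    obtain ⟨n, hn, w, hw, hnw⟩ := Submodule.mem_sup.mp ((Ideal.eq_top_iff_one _).mp htop)
    obtain ⟨y, rfl⟩ := Ideal.mem_span_singleton'.mp hw
    obtain ⟨y, rfl⟩ := Ideal.Quotient.mk_surjective y
    obtain ⟨m, -, hm⟩ := hI.2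
    have hnil : IsNilpotent (Ideal.Quotient.mk I (y * z)) :=
      ⟨m, by rw [← map_pow, Ideal.Quotient.eq_zero_iff_mem]
             exact hm (Ideal.pow_mem_pow (Ideal.mul_mem_left _ _ hz) m)⟩
    rw [← map_mul] at hnw
    rw [eq_sub_of_add_eq hnw] at hn
    exact hN.ne_top (Ideal.eq_top_of_isUnit_mem _ hn hnil.isUnit_one_sub)

/-- This is what J² = 0 contributes: R² ≤ I, hence I = R² by admissibility. -/
theorem mul_mem_of_mem_arrowIdeal (hI : IsAdmissible I) (hJ : Ring.jacobson (Lam I) ^ 2 = ⊥)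
    {x y : PathAlgebra K V} (hx : x ∈ arrowIdeal K V) (hy : y ∈ arrowIdeal K V) : x * y ∈ I := by
  have h : Ideal.Quotient.mk I x * Ideal.Quotient.mk I y ∈ Ring.jacobson (Lam I) ^ 2 := by
    rw [show (2 : ℕ) = 1 + 1 from rfl, Submodule.pow_add _ one_ne_zero, Submodule.pow_one]
    exact Ideal.mul_mem_mul ((mk_mem_jacobson_iff hI).mpr hx) ((mk_mem_jacobson_iff hI).mpr hy)
  rw [hJ, Ideal.mem_bot, ← map_mul] at h
  exact Ideal.Quotient.eq_zero_iff_mem.mp h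

end Algebra

/-! ### Tops, socles and dimension vectors of modules -/

section ModuleTheory

variable {K : Type u} [Field K] {V : Type v} [Fintype V] [Quiver.{w} V]
variable {I : Ideal (PathAlgebra K V)} [I.IsTwoSided]
variable {M : Type w₁} [AddCommGroup M] [Module (Lam I) M]

theorem mk_mul_smul (y z : PathAlgebra K V) (m : M) :
    Ideal.Quotient.mk I (y * z) • m = Ideal.Quotient.mk I y • Ideal.Quotient.mk I z • m := by
  rw [map_mul, mul_smul]

theorem sum_mk_vertex_smul (m : M) : ∑ i, Ideal.Quotient.mk I (vertex K i) • m = m := by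
  rw [← Finset.sum_smul, ← map_sum, sum_vertex, map_one, one_smul]

variable [Module K M] [IsScalarTower K (Lam I) M]
variable {N : Type w₂} [AddCommGroup N] [Module K N] [Module (Lam I) N] [IsScalarTower K (Lam I) N]

theorem mk_algebraMap_smul (c : K) (m : M) :
    Ideal.Quotient.mk I (algebraMap K _ c) • m = c • m :=
  algebraMap_smul (Lam I) c m

/-- A subspace which is stable under the vertices and the arrows is stable under `Λ`. -/
theorem mk_smul_mem {W : Submodule K M}
    (hv : ∀ i, ∀ m ∈ W, Ideal.Quotient.mk I (vertex K i) • m ∈ W)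
    (ha : ∀ a, ∀ m ∈ W, Ideal.Quotient.mk I (arrow K a) • m ∈ W) (z : PathAlgebra K V) :
    ∀ m ∈ W, Ideal.Quotient.mk I z • m ∈ W := by
  induction z using PathAlgebra.induction with
  | algebraMap c => intro m hm; rw [mk_algebraMap_smul]; exact W.smul_mem c hm
  | vertex i => exact hv i
  | arrow a => exact ha a
  | add x y hx hy => intro m hm; rw [map_add, add_smul]; exact W.add_mem (hx m hm) (hy m hm)
  | mul x y hx hy => intro m hm; rw [mk_mul_smul]; exact hx _ (hy m hm)

/-- The `Λ`-submodule of the elements that are annihilated by all arrows, as a subspace. -/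
def arrowKer (I : Ideal (PathAlgebra K V)) [I.IsTwoSided] (M : Type w₁) [AddCommGroup M]
    [Module K M] [Module (Lam I) M] [IsScalarTower K (Lam I) M] : Submodule K M :=
  ⨅ a : Arrow V, LinearMap.ker (Algebra.lsmul K K M (Ideal.Quotient.mk I (arrow K a)))

theorem mem_arrowKer {m : M} :
    m ∈ arrowKer I M ↔ ∀ a, Ideal.Quotient.mk I (arrow K a) • m = 0 := by
  simp [arrowKer]

theorem mk_smul_mem_arrowKer (z : PathAlgebra K V) {m : M} (hm : m ∈ arrowKer I M) :
    Ideal.Quotient.mk I z • m ∈ arrowKer I M := by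
  refine mk_smul_mem (fun i m hm => ?_) (fun a m hm => ?_) z m hm
  · rw [mem_arrowKer] at hm ⊢
    intro a
    rw [← mk_mul_smul]
    by_cases h : a.1 = i
    · rw [← h, arrow_mul_vertex, hm]
    · rw [arrow_mul_vertex_of_ne h, map_zero, zero_smul]
  · rw [mem_arrowKer.mp hm]
    exact zero_mem _

/-- The arrow ideal annihilates the elements that are annihilated by the arrows. -/
theorem mk_smul_eq_zero_of_mem {z : PathAlgebra K V} (hz : z ∈ arrowIdeal K V) {m : M}
    (hm : m ∈ arrowKer I M) : Ideal.Quotient.mk I z • m = 0 := by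
  induction hz using Submodule.span_induction with
  | mem z hz =>
    obtain ⟨a, p, q, rfl⟩ := hz
    rw [mul_assoc, mk_mul_smul, mk_mul_smul, mem_arrowKer.mp (mk_smul_mem_arrowKer q hm), smul_zero]
  | zero => rw [map_zero, zero_smul]
  | add x y _ _ hx hy => rw [map_add, add_smul, hx, hy, add_zero]
  | smul r x _ hx => rw [smul_eq_mul, mk_mul_smul, hx, smul_zero]

theorem arrowKer_eq_top_of_isSemisimpleModule (hI : IsAdmissible I) [IsSemisimpleModule (Lam I) M] :
    arrowKer I M = ⊤ := by
  rw [eq_top_iff]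
  intro m _
  rw [mem_arrowKer]
  intro a
  exact Module.mem_annihilator.mp (IsSemisimpleModule.jacobson_le_annihilator (Lam I) M
    ((mk_mem_jacobson_iff hI).mpr (arrow_mem_arrowIdeal a))) m

/-- The socle consists of the elements that are annihilated by the arrows. -/
theorem mem_soc_iff (hI : IsAdmissible I) {m : M} : m ∈ soc I M ↔ m ∈ arrowKer I M := by
  constructor
  · intro hm
    let W : Submodule (Lam I) M :=
      { arrowKer I M with
        smul_mem' := fun r m hm => by
          obtain ⟨z, rfl⟩ := Ideal.Quotient.mk_surjective r
          exact mk_smul_mem_arrowKer z hm }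
    have hle : soc I M ≤ W := by
      refine sSup_le fun S hS m hm => ?_
      have : IsSimpleModule (Lam I) S := hS
      have hS' := mem_arrowKer.mp ((arrowKer_eq_top_of_isSemisimpleModule (M := S) hI).ge
        (Submodule.mem_top (x := ⟨m, hm⟩)))
      exact mem_arrowKer.mpr fun a => congrArg Subtype.val (hS' a)
    exact hle hm
  · intro hm
    rw [← sum_mk_vertex_smul (I := I) m]
    refine Submodule.sum_mem _ fun i _ => ?_
    set n := Ideal.Quotient.mk I (vertex K i) • m with hn
    have hn' : n ∈ arrowKer I M := mk_smul_mem_arrowKer _ hm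
    by_cases h0 : n = 0
    · rw [h0]; exact zero_mem _
    -- The vector n = e_i m is killed by the arrows and fixed by e_i, so Λ acts on it through the
    -- character of i. It therefore spans a simple submodule, and m is the sum of these vectors.
    have hact : ∀ z : PathAlgebra K V, Ideal.Quotient.mk I z • n = character i z • n := by
      intro z
      obtain ⟨c, hc⟩ := exists_sub_sum_vertex_mem z
      have h1 : Ideal.Quotient.mk I z • n = c i • n := by
        have h2 := mk_smul_eq_zero_of_mem hc hn'
        rw [map_sub, sub_smul, sub_eq_zero] at h2
        rw [h2, map_sum, Finset.sum_smul, Finset.sum_eq_single i]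
        · rw [Algebra.smul_def, mk_mul_smul, mk_algebraMap_smul, hn, ← mk_mul_smul,
            vertex_mul_self]
        · intro j _ hj
          rw [Algebra.smul_def, mk_mul_smul, hn, ← mk_mul_smul (vertex K j), vertex_mul_of_ne hj,
            map_zero, zero_smul, smul_zero]
        · simp
      have h3 := character_eq_zero_of_mem hc i
      rw [map_sub, sub_eq_zero] at h3
      classical
      rw [h1, h3]
      simp [character_vertex]
    have hsimple : IsSimpleModule (Lam I) (Submodule.span (Lam I) {n}) := by
      rw [isSimpleModule_iff_toSpanSingleton_surjective]
      refine ⟨⟨⟨n, Submodule.mem_span_singleton_self n⟩, 0, fun h => h0 (congrArg Subtype.val h)⟩,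
        ?_⟩
      rintro ⟨y, hy⟩ hy0 ⟨y', hy'⟩
      obtain ⟨r, rfl⟩ := Submodule.mem_span_singleton.mp hy
      obtain ⟨r', rfl⟩ := Submodule.mem_span_singleton.mp hy'
      obtain ⟨z, rfl⟩ := Ideal.Quotient.mk_surjective r
      obtain ⟨z', rfl⟩ := Ideal.Quotient.mk_surjective r'
      have hz : character i z ≠ 0 := fun h => hy0 (Subtype.ext (by
        rw [Submodule.coe_zero]; exact (hact z).trans (by rw [h, zero_smul])))
      refine ⟨Ideal.Quotient.mk I (algebraMap K _ (character i z' * (character i z)⁻¹)),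
        Subtype.ext ?_⟩
      change Ideal.Quotient.mk I _ • Ideal.Quotient.mk I z • n = Ideal.Quotient.mk I z' • n
      rw [mk_algebraMap_smul, hact, hact, smul_smul, inv_mul_cancel_right₀ hz]
    exact (le_sSup (a := Submodule.span (Lam I) {n}) hsimple)
      (Submodule.mem_span_singleton_self n)

theorem arrowKer_soc (hI : IsAdmissible I) : arrowKer I (soc I M) = ⊤ := by
  rw [eq_top_iff]
  rintro ⟨m, hm⟩ _
  exact mem_arrowKer.mpr fun a => Subtype.ext (mem_arrowKer.mp ((mem_soc_iff hI).mp hm) a)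

theorem arrowKer_top (hI : IsAdmissible I) : arrowKer I (top I M) = ⊤ := by
  rw [eq_top_iff]
  intro m _
  obtain ⟨m, rfl⟩ := Submodule.mkQ_surjective _ m
  refine mem_arrowKer.mpr fun a => ?_
  rw [← map_smul, Submodule.mkQ_apply, Submodule.Quotient.mk_eq_zero]
  exact Submodule.smul_mem_smul ((mk_mem_jacobson_iff hI).mpr (arrow_mem_arrowIdeal a))
    Submodule.mem_top

theorem idem_eq (i : V) : idem I i = Ideal.Quotient.mk I (vertex K i) := rfl

theorem dimVec_congr (e : M ≃ₗ[Lam I] N) : dimVec I M = dimVec I N := by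
  funext i
  have : LinearMap.range (Algebra.lsmul K K N (idem I i)) =
      (LinearMap.range (Algebra.lsmul K K M (idem I i))).map
        (e.restrictScalars K : M →ₗ[K] N) := by
    ext n
    constructor
    · rintro ⟨n, rfl⟩
      exact ⟨idem I i • e.symm n, ⟨e.symm n, rfl⟩, by simp⟩
    · rintro ⟨_, ⟨m, rfl⟩, rfl⟩
      exact ⟨e m, by simp⟩
  rw [dimVec, dimVec, this]
  exact (LinearEquiv.finrank_map_eq (e.restrictScalars K) _).symm

/-- Isomorphic modules have isomorphic tops. -/
def topCongr (e : M ≃ₗ[Lam I] N) : top I M ≃ₗ[Lam I] top I N :=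
  Submodule.Quotient.equiv _ _ e (by
    rw [Submodule.map_smul'', Submodule.map_top, LinearEquiv.range])

/-- Isomorphic modules have isomorphic socles. -/
def socCongr (hI : IsAdmissible I) (e : M ≃ₗ[Lam I] N) : soc I M ≃ₗ[Lam I] soc I N :=
  e.ofSubmodules _ _ (by
    ext n
    rw [Submodule.mem_map_equiv, mem_soc_iff hI, mem_soc_iff hI, mem_arrowKer, mem_arrowKer]
    refine forall_congr' fun a => ?_
    rw [← map_smul, EmbeddingLike.map_eq_zero_iff])

theorem topSocPair_congr (hI : IsAdmissible I) (e : M ≃ₗ[Lam I] N) :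
    topSocPair I M = topSocPair I N := by
  rw [topSocPair, topSocPair, dimVec_congr (topCongr e), dimVec_congr (socCongr hI e)]

end ModuleTheory

/-! ### The modules `M(x)` -/

section RepModule

variable {K : Type u} [Field K] {V : Type v} [Quiver.{w} V] {d : V → ℕ}

/-- The sum of the images of the matrices of the arrows that end at `i`. -/
def imSub (x : RepSpace K d) (i : V) : Submodule K (Fin (d i) → K) :=
  ⨆ (j : V) (α : j ⟶ i), LinearMap.range (Matrix.mulVecLin (x ⟨j, i, α⟩))

/-- The intersection of the kernels of the matrices of the arrows that start at `i`. -/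
def kerSub (x : RepSpace K d) (i : V) : Submodule K (Fin (d i) → K) :=
  ⨅ (j : V) (α : i ⟶ j), LinearMap.ker (Matrix.mulVecLin (x ⟨i, j, α⟩))

theorem mulVec_mem_imSub (x : RepSpace K d) (a : Arrow V) (v : Fin (d a.1) → K) :
    (x a).mulVec v ∈ imSub x a.2.1 :=
  Submodule.mem_iSup_of_mem a.1 (Submodule.mem_iSup_of_mem a.2.2 ⟨v, rfl⟩)

theorem mem_kerSub {x : RepSpace K d} {i : V} {v : Fin (d i) → K} :
    v ∈ kerSub x i ↔ ∀ (j : V) (α : i ⟶ j), (x ⟨i, j, α⟩).mulVec v = 0 := by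
  simp [kerSub]

variable [Fintype V]

theorem pathAction_vertex (x : RepSpace K d) (i : V) :
    pathAction x (vertex K i) = genAction x (Sum.inl i) :=
  (RingQuot.liftAlgHom_mkAlgHom_apply K _ _ _).trans (by simp)

theorem pathAction_arrow (x : RepSpace K d) (a : Arrow V) :
    pathAction x (arrow K a) = genAction x (Sum.inr a) :=
  (RingQuot.liftAlgHom_mkAlgHom_apply K _ _ _).trans (by simp)

open Classical in
theorem pathAction_vertex_apply (x : RepSpace K d) (i : V) (m : ∀ i, Fin (d i) → K) :
    pathAction x (vertex K i) m = Pi.single i (m i) := by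
  rw [pathAction_vertex]; rfl

open Classical in
theorem pathAction_arrow_apply (x : RepSpace K d) (a : Arrow V) (m : ∀ i, Fin (d i) → K) :
    pathAction x (arrow K a) m = Pi.single a.2.1 ((x a).mulVec (m a.1)) := by
  rw [pathAction_arrow]; rfl

/-- Consecutive arrows act as zero if and only if images lie in kernels. -/
theorem imSub_le_kerSub_of_arrow_mul {x : RepSpace K d}
    (h : ∀ a b : Arrow V, pathAction x (arrow K b * arrow K a) = 0) (i : V) :
    imSub x i ≤ kerSub x i := by
  classical
  refine iSup_le fun j => iSup_le fun α => ?_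
  rintro _ ⟨v, rfl⟩
  rw [mem_kerSub]
  intro k β
  have := congrFun (LinearMap.congr_fun (h ⟨j, i, α⟩ ⟨i, k, β⟩) (Pi.single j v)) k
  simpa [Module.End.mul_apply, pathAction_arrow_apply] using this

/-- The direct sum W of the spaces `kerSub x i` is a submodule. The arrow ideal sends everything
into W, because images lie in kernels, and it kills W; so its square acts as zero. -/
theorem pathAction_eq_zero_of_mem {x : RepSpace K d} (h : ∀ i, imSub x i ≤ kerSub x i)
    {z : PathAlgebra K V} (hz : z ∈ arrowIdeal K V ^ 2) : pathAction x z = 0 := by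
  classical
  let W : Submodule K (∀ i, Fin (d i) → K) := ⨅ i, (kerSub x i).comap (LinearMap.proj i)
  have hW : ∀ m, m ∈ W ↔ ∀ i, m i ∈ kerSub x i := by simp [W]
  have harrow : ∀ a, ∀ m ∈ W, pathAction x (arrow K a) m = 0 := by
    intro a m hm
    rw [pathAction_arrow_apply, mem_kerSub.mp ((hW m).mp hm a.1) a.2.1 a.2.2, Pi.single_zero]
  have harrow' : ∀ a m, pathAction x (arrow K a) m ∈ W := by
    intro a m
    rw [hW]
    intro i
    rw [pathAction_arrow_apply]
    by_cases hi : i = a.2.1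
    · subst hi
      rw [Pi.single_eq_same]
      exact h _ (mulVec_mem_imSub x a _)
    · rw [Pi.single_eq_of_ne hi]
      exact zero_mem _
  have hstable : ∀ z : PathAlgebra K V, ∀ m ∈ W, pathAction x z m ∈ W := by
    intro z
    induction z using PathAlgebra.induction with
    | algebraMap c => intro m hm; rw [AlgHom.commutes]; exact W.smul_mem c hm
    | vertex i =>
      intro m hm
      rw [hW] at hm ⊢
      intro j
      rw [pathAction_vertex_apply]
      by_cases hj : j = i
      · subst hj
        rw [Pi.single_eq_same]
        exact hm j
      · rw [Pi.single_eq_of_ne hj]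
        exact zero_mem _
    | arrow a => intro m _; exact harrow' a m
    | add y z hy hz => intro m hm; rw [map_add]; exact W.add_mem (hy m hm) (hz m hm)
    | mul y z hy hz => intro m hm; rw [map_mul]; exact hy _ (hz m hm)
  have hR : ∀ z ∈ arrowIdeal K V, (∀ m, pathAction x z m ∈ W) ∧
      ∀ m ∈ W, pathAction x z m = 0 := by
    intro z hz
    induction hz using Submodule.span_induction with
    | mem z hz =>
      obtain ⟨a, p, q, rfl⟩ := hz
      simp only [map_mul, Module.End.mul_apply]
      exact ⟨fun m => hstable p _ (harrow' a _), fun m hm => by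
        rw [harrow a _ (hstable q m hm), map_zero]⟩
    | zero => simp only [map_zero]; exact ⟨fun m => W.zero_mem, fun m _ => rfl⟩
    | add y z _ _ hy hz =>
      simp only [map_add, LinearMap.add_apply]
      exact ⟨fun m => W.add_mem (hy.1 m) (hz.1 m), fun m hm => by
        rw [hy.2 m hm, hz.2 m hm, add_zero]⟩
    | smul r z _ hz =>
      simp only [smul_eq_mul, map_mul, Module.End.mul_apply]
      exact ⟨fun m => hstable r _ (hz.1 m), fun m hm => by rw [hz.2 m hm, map_zero]⟩
  have hle : arrowIdeal K V ^ 2 ≤ RingHom.ker (pathAction x) := by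
    rw [show (2 : ℕ) = 1 + 1 from rfl, Submodule.pow_add _ one_ne_zero, Submodule.pow_one]
    refine Ideal.mul_le.mpr fun y hy z hz => LinearMap.ext fun m => ?_
    rw [map_mul]
    exact (hR y hy).2 _ ((hR z hz).1 m)
  exact hle hz

variable {I : Ideal (PathAlgebra K V)}

/-- `Rep_d(Λ)` consists of the families such that images of arrows lie in kernels of arrows. -/
theorem mem_rep_iff [I.IsTwoSided] (hI : IsAdmissible I) (hJ : Ring.jacobson (Lam I) ^ 2 = ⊥)
    {x : RepSpace K d} : (∀ r ∈ I, pathAction x r = 0) ↔ ∀ i, imSub x i ≤ kerSub x i :=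
  ⟨fun h i => imSub_le_kerSub_of_arrow_mul (fun a b => h _ (mul_mem_of_mem_arrowIdeal hI hJ
    (arrow_mem_arrowIdeal b) (arrow_mem_arrowIdeal a))) i,
    fun h _ hr => pathAction_eq_zero_of_mem h (hI.1 hr)⟩

namespace RepModule

open Classical in
/-- The inclusion of `K ^ {d_i}` into `M(x)`. -/
def single (x : Rep I d) (i : V) : (Fin (d i) → K) →ₗ[K] RepModule x :=
  LinearMap.single K (fun i : V => Fin (d i) → K) i

/-- The projection of `M(x)` to `K ^ {d_i}`. -/
def proj (x : Rep I d) (i : V) : RepModule x →ₗ[K] (Fin (d i) → K) :=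
  LinearMap.proj i

variable {x : Rep I d}

theorem proj_single_self (i : V) (v : Fin (d i) → K) : proj x i (single x i v) = v := by
  classical exact Pi.single_eq_same (M := fun i : V => Fin (d i) → K) i v

theorem proj_single_of_ne {i j : V} (h : j ≠ i) (v : Fin (d i) → K) :
    proj x j (single x i v) = 0 := by
  classical exact Pi.single_eq_of_ne (M := fun i : V => Fin (d i) → K) h v

theorem proj_mem_of_single {W : ∀ i, Submodule K (Fin (d i) → K)} {i j : V} {v : Fin (d i) → K}
    (hv : v ∈ W i) : proj x j (single x i v) ∈ W j := by
  by_cases h : j = i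
  · subst h; rwa [proj_single_self]
  · rw [proj_single_of_ne h]; exact zero_mem _

variable [I.IsTwoSided]

theorem mk_vertex_smul (i : V) (m : RepModule x) :
    Ideal.Quotient.mk I (vertex K i) • m = single x i (proj x i m) :=
  pathAction_vertex_apply x.1 i m

theorem mk_arrow_smul (a : Arrow V) (m : RepModule x) :
    Ideal.Quotient.mk I (arrow K a) • m = single x a.2.1 ((x.1 a).mulVec (proj x a.1 m)) :=
  pathAction_arrow_apply x.1 a m

theorem sum_single_proj (m : RepModule x) : ∑ i, single x i (proj x i m) = m := by
  simp only [← mk_vertex_smul]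
  exact sum_mk_vertex_smul m

instance : Module.Finite K (RepModule x) :=
  inferInstanceAs (Module.Finite K (∀ i : V, Fin (d i) → K))

/-- The direct sum of the spaces `imSub x.1 i` is stable under Λ and contains the image of every
arrow, so it contains J M; conversely each generator is an arrow applied to a vector. -/
theorem mem_jacobson_smul_top_iff (hI : IsAdmissible I) {m : RepModule x} :
    m ∈ Ring.jacobson (Lam I) • (⊤ : Submodule (Lam I) (RepModule x)) ↔
      ∀ i, proj x i m ∈ imSub x.1 i := by
  constructor
  · let W : Submodule K (RepModule x) := ⨅ i, (imSub x.1 i).comap (proj x i)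
    have hW : ∀ m, m ∈ W ↔ ∀ i, proj x i m ∈ imSub x.1 i := by simp [W]
    have harrow : ∀ a m, Ideal.Quotient.mk I (arrow K a) • m ∈ W := by
      intro a m
      rw [hW, mk_arrow_smul]
      exact fun j => proj_mem_of_single (mulVec_mem_imSub _ _ _)
    have hstable := mk_smul_mem (I := I) (W := W) (fun i m hm => by
      rw [hW] at hm ⊢
      intro j
      rw [mk_vertex_smul]
      exact proj_mem_of_single (hm i)) (fun a m _ => harrow a m)
    have hR : ∀ z ∈ arrowIdeal K V, ∀ m : RepModule x, Ideal.Quotient.mk I z • m ∈ W := by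
      intro z hz
      induction hz using Submodule.span_induction with
      | mem z hz =>
        obtain ⟨a, p, q, rfl⟩ := hz
        intro m
        rw [mk_mul_smul, mk_mul_smul]
        exact hstable p _ (harrow a _)
      | zero => intro m; rw [map_zero, zero_smul]; exact W.zero_mem
      | add y z _ _ hy hz => intro m; rw [map_add, add_smul]; exact W.add_mem (hy m) (hz m)
      | smul r z _ hz => intro m; rw [smul_eq_mul, mk_mul_smul]; exact hstable r _ (hz m)
    intro hm
    rw [← hW]
    induction hm using Submodule.smul_induction_on' with
    | smul r hr n hn =>
      obtain ⟨z, rfl⟩ := Ideal.Quotient.mk_surjective r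
      exact hR z ((mk_mem_jacobson_iff hI).mp hr) n
    | add m _ n _ hm hn => exact W.add_mem hm hn
  · intro hm
    rw [← sum_single_proj m]
    refine Submodule.sum_mem _ fun i _ => ?_
    let W : Submodule K (RepModule x) :=
      (Ring.jacobson (Lam I) • (⊤ : Submodule (Lam I) (RepModule x))).restrictScalars K
    have hle : imSub x.1 i ≤ W.comap (single x i) := by
      refine iSup_le fun j => iSup_le fun α => ?_
      rintro _ ⟨v, rfl⟩
      have h1 : single x i ((x.1 ⟨j, i, α⟩).mulVec v) =
          Ideal.Quotient.mk I (arrow K ⟨j, i, α⟩) • single x j v := by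
        rw [mk_arrow_smul, proj_single_self]
      change single x i ((x.1 ⟨j, i, α⟩).mulVec v) ∈
        Ring.jacobson (Lam I) • (⊤ : Submodule (Lam I) (RepModule x))
      rw [h1]
      exact Submodule.smul_mem_smul ((mk_mem_jacobson_iff hI).mpr (arrow_mem_arrowIdeal _))
        Submodule.mem_top
    exact hle (hm i)

theorem mem_soc_iff_proj (hI : IsAdmissible I) {m : RepModule x} :
    m ∈ soc I (RepModule x) ↔ ∀ i, proj x i m ∈ kerSub x.1 i := by
  rw [mem_soc_iff hI, mem_arrowKer]
  simp only [mem_kerSub, mk_arrow_smul]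
  constructor
  · intro h i j α
    rw [← proj_single_self (x := x) j ((x.1 ⟨i, j, α⟩).mulVec (proj x i m)), h ⟨i, j, α⟩, map_zero]
  · intro h a
    rw [h a.1 a.2.1 a.2.2, map_zero]

theorem dimVec_eq (x : Rep I d) : dimVec I (RepModule x) = d := by
  funext i
  have h : LinearMap.range (Algebra.lsmul K K (RepModule x) (idem I i)) =
      LinearMap.range (single x i) := by
    ext m
    constructor
    · rintro ⟨m, rfl⟩
      exact ⟨proj x i m, (mk_vertex_smul i m).symm⟩
    · rintro ⟨v, rfl⟩
      exact ⟨single x i v, (mk_vertex_smul i _).trans (by rw [proj_single_self])⟩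
  have hinj : Function.Injective (single x i) :=
    Function.LeftInverse.injective (g := proj x i) (proj_single_self i)
  rw [dimVec, h, LinearMap.finrank_range_of_inj hinj, Module.finrank_fin_fun]

theorem hasDimVec (x : Rep I d) : HasDimVec I (RepModule x) d :=
  ⟨inferInstance, dimVec_eq x⟩

/-- The space e_i (M / J M) is the quotient of K ^ {d_i} by `imSub x.1 i`. The additive form avoids
truncated subtraction. -/
theorem dimVec_top_add (hI : IsAdmissible I) (x : Rep I d) (i : V) :
    dimVec I (top I (RepModule x)) i + Module.finrank K (imSub x.1 i) = d i := by
  let JM : Submodule (Lam I) (RepModule x) := Ring.jacobson (Lam I) • ⊤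
  let π : (Fin (d i) → K) →ₗ[K] top I (RepModule x) := (JM.mkQ.restrictScalars K) ∘ₗ single x i
  have h : LinearMap.range (Algebra.lsmul K K (top I (RepModule x)) (idem I i)) =
      LinearMap.range π := by
    ext m
    constructor
    · rintro ⟨m, rfl⟩
      obtain ⟨m, rfl⟩ := Submodule.mkQ_surjective _ m
      refine ⟨proj x i m, ?_⟩
      change JM.mkQ (single x i (proj x i m)) = idem I i • JM.mkQ m
      rw [← map_smul, idem_eq, mk_vertex_smul]
    · rintro ⟨v, rfl⟩
      refine ⟨π v, ?_⟩
      change idem I i • JM.mkQ (single x i v) = JM.mkQ (single x i v)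
      rw [← map_smul, idem_eq, mk_vertex_smul, proj_single_self]
  have hker : LinearMap.ker π = imSub x.1 i := by
    ext v
    rw [LinearMap.mem_ker]
    change JM.mkQ (single x i v) = 0 ↔ _
    rw [Submodule.mkQ_apply, Submodule.Quotient.mk_eq_zero, mem_jacobson_smul_top_iff hI]
    exact ⟨fun hv => by simpa only [proj_single_self] using hv i, fun hv j => proj_mem_of_single hv⟩
  rw [dimVec, h, ← hker, LinearMap.finrank_range_add_finrank_ker, Module.finrank_fin_fun]

theorem dimVec_soc (hI : IsAdmissible I) (x : Rep I d) (i : V) :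
    dimVec I (soc I (RepModule x)) i = Module.finrank K (kerSub x.1 i) := by
  have hmem : ∀ v ∈ kerSub x.1 i, single x i v ∈ soc I (RepModule x) := fun v hv =>
    (mem_soc_iff_proj hI).mpr fun j => proj_mem_of_single hv
  let π : kerSub x.1 i →ₗ[K] soc I (RepModule x) :=
    { toFun := fun v => ⟨single x i v, hmem v v.2⟩
      map_add' := fun v w => Subtype.ext (map_add (single x i) v.1 w.1)
      map_smul' := fun c v => Subtype.ext (map_smul (single x i) c v.1) }
  have h : LinearMap.range (Algebra.lsmul K K (soc I (RepModule x)) (idem I i)) =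
      LinearMap.range π := by
    ext m
    constructor
    · rintro ⟨m, rfl⟩
      exact ⟨⟨proj x i m.1, (mem_soc_iff_proj hI).mp m.2 i⟩,
        Subtype.ext (mk_vertex_smul i m.1).symm⟩
    · rintro ⟨v, rfl⟩
      exact ⟨π v, Subtype.ext ((mk_vertex_smul i _).trans
        (congrArg (single x i) (proj_single_self i v.1)))⟩
  have hinj : Function.Injective π := fun v w hvw => Subtype.ext (by
    have := congrArg (proj x i) (congrArg Subtype.val hvw)
    exact (proj_single_self i v.1).symm.trans (this.trans (proj_single_self i w.1)))
  rw [dimVec, h, LinearMap.finrank_range_of_inj hinj]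

end RepModule

end RepModule

/-! ### Every module is isomorphic to some `M(x)` -/

section Classification

variable {K : Type u} [Field K] {V : Type v} [Fintype V] [Quiver.{w} V] {d : V → ℕ}
variable {I : Ideal (PathAlgebra K V)} [I.IsTwoSided]
variable {M : Type w₁} [AddCommGroup M] [Module (Lam I) M]

theorem idem_smul_idem_smul (i : V) (m : M) : idem I i • idem I i • m = idem I i • m := by
  rw [idem_eq, ← mk_mul_smul, vertex_mul_self]

theorem idem_smul_idem_smul_of_ne {i j : V} (h : i ≠ j) (m : M) :
    idem I i • idem I j • m = 0 := by
  rw [idem_eq, idem_eq, ← mk_mul_smul, vertex_mul_of_ne h, map_zero, zero_smul]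

variable [Module K M] [IsScalarTower K (Lam I) M]
variable {N : Type w₂} [AddCommGroup N] [Module K N] [Module (Lam I) N] [IsScalarTower K (Lam I) N]

open Classical in
/-- Coordinates on a module with dimension vector `d` that are adapted to the vertices. -/
theorem exists_coordinates (hM : HasDimVec I M d) :
    ∃ φ : M ≃ₗ[K] (∀ i : V, Fin (d i) → K), ∀ (m : M) (i : V),
      φ (idem I i • m) = Pi.single i (φ m i) := by
  have := hM.1
  let p : V → M →ₗ[K] M := fun i => Algebra.lsmul K K M (idem I i)
  have hp : ∀ i m, p i m = idem I i • m := fun _ _ => rfl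
  have hdim : ∀ i, Module.finrank K (LinearMap.range (p i)) = Module.finrank K (Fin (d i) → K) :=
    fun i => by rw [Module.finrank_fin_fun, ← hM.2]; rfl
  let b : ∀ i, LinearMap.range (p i) ≃ₗ[K] (Fin (d i) → K) := fun i =>
    LinearEquiv.ofFinrankEq _ _ (hdim i)
  let φ : M →ₗ[K] (∀ i : V, Fin (d i) → K) :=
    LinearMap.pi fun i => (b i).toLinearMap ∘ₗ (p i).rangeRestrict
  have hφ : ∀ m i, φ m i = b i ((p i).rangeRestrict m) := fun _ _ => rfl
  let ψ : (∀ i : V, Fin (d i) → K) →ₗ[K] M :=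
    ∑ i, (LinearMap.range (p i)).subtype ∘ₗ (b i).symm.toLinearMap ∘ₗ LinearMap.proj i
  have hψ : ∀ v, ψ v = ∑ i, ((b i).symm (v i) : M) := fun v => by simp [ψ]
  -- Orthogonality of the idempotents: p i is the identity on its own range and zero on the others.
  -- This makes φ and ψ mutually inverse.
  have hpp : ∀ i j (y : LinearMap.range (p j)),
      (p i).rangeRestrict (y : M) = if h : i = j then h ▸ y else 0 := by
    rintro i j ⟨_, m, rfl⟩
    apply Subtype.ext
    by_cases h : i = j
    · subst h
      simp [hp, idem_smul_idem_smul]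
    · simp [h, hp, idem_smul_idem_smul_of_ne h]
  refine ⟨LinearEquiv.ofLinearMap φ ψ (LinearMap.ext fun v => ?_) (LinearMap.ext fun m => ?_),
    fun m i => funext fun j => ?_⟩
  · funext i
    rw [LinearMap.comp_apply, hφ, hψ, map_sum, map_sum, Finset.sum_eq_single i]
    · simp [hpp]
    · intro j _ hj
      simp [hpp, hj.symm]
    · simp
  · rw [LinearMap.comp_apply, hψ]
    simp only [hφ, LinearEquiv.symm_apply_apply]
    exact sum_mk_vertex_smul m
  · change φ _ j = (Pi.single i (φ m i) : ∀ i : V, Fin (d i) → K) j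
    rw [hφ]
    by_cases h : j = i
    · subst h
      rw [Pi.single_eq_same, hφ]
      exact congrArg (b j) (Subtype.ext (idem_smul_idem_smul j m))
    · rw [Pi.single_eq_of_ne h, ← map_zero (b j)]
      exact congrArg (b j) (Subtype.ext (idem_smul_idem_smul_of_ne h m))

open Classical in
/-- Every module with dimension vector `d` is isomorphic to `M(x)` for some `x` in `Rep_d(Λ)`. -/
theorem exists_equiv_repModule (hM : HasDimVec I M d) :
    ∃ x : Rep I d, Nonempty (M ≃ₗ[Lam I] RepModule x) := by
  obtain ⟨φ, hsingle⟩ := exists_coordinates hM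
  let x : RepSpace K d := fun a => LinearMap.toMatrix' (LinearMap.proj a.2.1 ∘ₗ φ.toLinearMap ∘ₗ
    Algebra.lsmul K K M (Ideal.Quotient.mk I (arrow K a)) ∘ₗ φ.symm.toLinearMap ∘ₗ
      LinearMap.single K (fun i : V => Fin (d i) → K) a.1)
  have hx : ∀ a v, (x a).mulVec v =
      φ (Ideal.Quotient.mk I (arrow K a) • φ.symm (Pi.single a.1 v)) a.2.1 := fun a v => by
    rw [LinearMap.toMatrix'_mulVec]; rfl
  -- In these coordinates each arrow has a single nonzero block, which is x a; so φ intertwines the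
  -- two actions on generators, hence everywhere.
  have heq : ∀ (z : PathAlgebra K V) (m : M),
      φ (Ideal.Quotient.mk I z • m) = pathAction x z (φ m) := by
    intro z
    induction z using PathAlgebra.induction with
    | algebraMap c =>
      intro m
      rw [mk_algebraMap_smul, map_smul, AlgHom.commutes]
      rfl
    | vertex i =>
      intro m
      rw [pathAction_vertex_apply, ← idem_eq, hsingle]
    | arrow a =>
      intro m
      have h1 : Ideal.Quotient.mk I (arrow K a) • m =
          idem I a.2.1 • Ideal.Quotient.mk I (arrow K a) • idem I a.1 • m := by
        rw [idem_eq, idem_eq, ← mk_mul_smul, ← mk_mul_smul, mul_assoc, arrow_mul_vertex,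
          vertex_mul_arrow]
      rw [pathAction_arrow_apply, hx, ← hsingle, ← hsingle, LinearEquiv.symm_apply_apply, ← h1]
    | add y z hy hz => intro m; rw [map_add, add_smul, map_add, hy, hz, map_add]; rfl
    | mul y z hy hz => intro m; rw [mk_mul_smul, hy, hz, map_mul]; rfl
  let X : Rep I d := ⟨x, fun r hr => LinearMap.ext fun v => by
    obtain ⟨m, rfl⟩ := φ.surjective v
    rw [← heq, Ideal.Quotient.eq_zero_iff_mem.mpr hr, zero_smul, map_zero]
    rfl⟩
  exact ⟨X, ⟨{ φ.toAddEquiv with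
    map_smul' := fun r m => by
      obtain ⟨z, rfl⟩ := Ideal.Quotient.mk_surjective r
      exact heq z m }⟩⟩

/-- Finite dimensional modules that are annihilated by the arrows are determined by their dimension
vectors. -/
theorem nonempty_equiv_of_dimVec_eq [Module.Finite K M] [Module.Finite K N]
    (hM : arrowKer I M = ⊤) (hN : arrowKer I N = ⊤) (h : dimVec I M = dimVec I N) :
    Nonempty (M ≃ₗ[Lam I] N) := by
  obtain ⟨x, ⟨e⟩⟩ := exists_equiv_repModule (I := I) (M := M) (d := dimVec I N) ⟨inferInstance, h⟩
  obtain ⟨y, ⟨f⟩⟩ := exists_equiv_repModule (I := I) (M := N) (d := dimVec I N) ⟨inferInstance, rfl⟩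
  -- If all arrows act as zero, the point is the zero family; so both modules are M(x) for the same
  -- x.
  have hzero : ∀ (z : Rep I (dimVec I N)),
      (∀ a (m : RepModule z), Ideal.Quotient.mk I (arrow K a) • m = 0) → ∀ a, z.1 a = 0 := by
    intro z hz a
    refine Matrix.ext_of_mulVec_single fun j => ?_
    rw [Matrix.zero_mulVec, ← RepModule.proj_single_self (x := z) a.2.1 ((z.1 a).mulVec _)]
    conv_lhs => rw [← RepModule.proj_single_self (x := z) a.1 (Pi.single j 1)]
    rw [← RepModule.mk_arrow_smul, hz, map_zero]
  have hx : x = y := by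
    refine Subtype.ext (funext fun a => ?_)
    rw [hzero x (fun a m => ?_), hzero y (fun a m => ?_)]
    · rw [← f.apply_symm_apply m, ← map_smul, mem_arrowKer.mp (hN.ge Submodule.mem_top), map_zero]
    · rw [← e.apply_symm_apply m, ← map_smul, mem_arrowKer.mp (hM.ge Submodule.mem_top), map_zero]
  subst hx
  exact ⟨e.trans f.symm⟩

end Classification

/-! ### Polynomial functions and the Zariski topology -/

section Zariski

open scoped Topology

variable {K : Type u} [Field K] {σ : Type w₁} {τ : Type w₂}

/-- A function on `K ^ σ` is polynomial if it is given by evaluating a polynomial. -/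
def IsPolynomial (f : (σ → K) → K) : Prop :=
  ∃ p : MvPolynomial σ K, ∀ x, f x = MvPolynomial.eval x p

namespace IsPolynomial

theorem const (c : K) : IsPolynomial fun _ : σ → K => c :=
  ⟨MvPolynomial.C c, by simp⟩

theorem coord (s : σ) : IsPolynomial fun x : σ → K => x s :=
  ⟨MvPolynomial.X s, by simp⟩

theorem mul {f g : (σ → K) → K} (hf : IsPolynomial f) (hg : IsPolynomial g) :
    IsPolynomial fun x => f x * g x := by
  obtain ⟨p, hp⟩ := hf
  obtain ⟨q, hq⟩ := hg
  exact ⟨p * q, fun x => by simp only [map_mul, hp, hq]⟩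

theorem sum {ι : Type*} {s : Finset ι} {f : ι → (σ → K) → K}
    (hf : ∀ i ∈ s, IsPolynomial (f i)) : IsPolynomial fun x => ∑ i ∈ s, f i x := by
  choose! p hp using hf
  exact ⟨∑ i ∈ s, p i, fun x => by
    rw [map_sum]; exact Finset.sum_congr rfl fun i hi => hp i hi x⟩

theorem prod {ι : Type*} {s : Finset ι} {f : ι → (σ → K) → K}
    (hf : ∀ i ∈ s, IsPolynomial (f i)) : IsPolynomial fun x => ∏ i ∈ s, f i x := by
  choose! p hp using hf
  exact ⟨∏ i ∈ s, p i, fun x => by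
    rw [map_prod]; exact Finset.prod_congr rfl fun i hi => hp i hi x⟩

theorem linear [Finite σ] (f : (σ → K) →ₗ[K] K) : IsPolynomial f := by
  classical
  cases nonempty_fintype σ
  have : (f : (σ → K) → K) = fun x => ∑ s, x s * f (Pi.single s 1) := by
    funext x
    conv_lhs => rw [← Finset.univ_sum_single x]
    rw [map_sum]
    refine Finset.sum_congr rfl fun s _ => ?_
    rw [← smul_eq_mul, ← map_smul, ← Pi.single_smul, smul_eq_mul, mul_one]
  rw [this]
  exact sum fun s _ => (coord s).mul (const _)

theorem det {n : Type*} [Fintype n] [DecidableEq n] {A : (σ → K) → Matrix n n K}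
    (hA : ∀ i j, IsPolynomial fun x => A x i j) : IsPolynomial fun x => (A x).det := by
  simp only [Matrix.det_apply']
  exact sum fun s _ => (const _).mul (prod fun i _ => hA _ _)

theorem adjugate {n : Type*} [Fintype n] [DecidableEq n] {A : (σ → K) → Matrix n n K}
    (hA : ∀ i j, IsPolynomial fun x => A x i j) (i j : n) :
    IsPolynomial fun x => (A x).adjugate i j := by
  simp only [Matrix.adjugate_apply]
  refine det fun k l => ?_
  by_cases h : k = j
  · subst h
    simpa using const _
  · simpa [Matrix.updateRow_ne h] using hA k l

theorem matrix_mul {l m n : Type*} [Fintype m] {A : (σ → K) → Matrix l m K}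
    {B : (σ → K) → Matrix m n K} (hA : ∀ i j, IsPolynomial fun x => A x i j)
    (hB : ∀ i j, IsPolynomial fun x => B x i j) (i : l) (j : n) :
    IsPolynomial fun x => (A x * B x) i j := by
  simp only [Matrix.mul_apply]
  exact sum fun k _ => (hA i k).mul (hB k j)

theorem comp {f : (σ → K) → K} (hf : IsPolynomial f) {φ : (τ → K) → σ → K}
    (hφ : ∀ s, IsPolynomial fun x => φ x s) : IsPolynomial fun x => f (φ x) := by
  obtain ⟨p, hp⟩ := hf
  choose q hq using hφ
  refine ⟨MvPolynomial.bind₁ q p, fun x => ?_⟩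
  refine (hp _).trans (Eq.trans ?_ (MvPolynomial.eval₂Hom_bind₁ _ _ _ _).symm)
  exact congrArg (fun y => MvPolynomial.eval y p) (funext fun s => hq s x)

theorem isOpen_ne_zero {f : (σ → K) → K} (hf : IsPolynomial f) :
    IsOpen[zariski K σ] {x | f x ≠ 0} := by
  obtain ⟨p, hp⟩ := hf
  refine ⟨{p}, ?_⟩
  ext x
  simp [hp]

theorem continuous {φ : (τ → K) → σ → K} (hφ : ∀ s, IsPolynomial fun x => φ x s) :
    @Continuous _ _ (zariski K τ) (zariski K σ) φ := by
  let := zariski K τ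
  let := zariski K σ
  refine continuous_def.mpr ?_
  rintro U ⟨S, hS⟩
  refine ⟨{q | ∃ p ∈ S, ∀ x, MvPolynomial.eval x q = MvPolynomial.eval (φ x) p}, ?_⟩
  rw [← Set.preimage_compl, hS]
  ext x
  constructor
  · rintro hx q ⟨p, hp, hqp⟩
    rw [hqp]
    exact hx p hp
  · intro hx p hp
    obtain ⟨q, hq⟩ := comp (⟨p, fun _ => rfl⟩ : IsPolynomial fun y => MvPolynomial.eval y p) hφ
    refine (hq x).trans ?_
    exact hx q ⟨p, hp, fun x => (hq x).symm⟩

end IsPolynomial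

/-- Affine space over an infinite field is irreducible. -/
theorem isPreirreducible_univ_zariski [Infinite K] :
    @IsPreirreducible _ (zariski K σ) Set.univ := by
  let := zariski K σ
  have key : ∀ U : Set (σ → K), IsOpen U → (Set.univ ∩ U).Nonempty →
      ∃ p : MvPolynomial σ K, p ≠ 0 ∧ ∀ x, MvPolynomial.eval x p ≠ 0 → x ∈ U := by
    rintro U ⟨S, hS⟩ ⟨x, -, hx⟩
    have hx' : x ∉ Uᶜ := fun h => h hx
    rw [hS] at hx'
    simp only [Set.mem_ofPred_eq, not_forall] at hx'
    obtain ⟨p, hp, hpx⟩ := hx'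
    refine ⟨p, fun h => hpx (by rw [h, map_zero]), fun y hy => ?_⟩
    by_contra hyU
    have : y ∈ Uᶜ := hyU
    rw [hS] at this
    exact hy (this p hp)
  intro U W hU hW hU' hW'
  obtain ⟨p, hp, hpU⟩ := key U hU hU'
  obtain ⟨q, hq, hqW⟩ := key W hW hW'
  by_contra h
  -- If the two open sets were disjoint, p q would vanish at every point, hence be the zero
  -- polynomial because K is infinite.
  refine mul_ne_zero hp hq (MvPolynomial.funext fun x => ?_)
  rw [map_zero, map_mul]
  by_contra hx
  exact h ⟨x, trivial, hpU x (left_ne_zero_of_mul hx), hqW x (right_ne_zero_of_mul hx)⟩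

variable {E : Type*} [AddCommGroup E] [Module K E] {F : Type*} [AddCommGroup F] [Module K F]

/-- The rank of a linear map is at least `n` if and only if some `n × n` matrix of values of
functionals on the image is invertible. -/
theorem le_finrank_range_iff [Module.Finite K F] (f : E →ₗ[K] F) (n : ℕ) :
    n ≤ Module.finrank K (LinearMap.range f) ↔
      ∃ (e : Fin n → E) (φ : Fin n → Module.Dual K F),
        (Matrix.of fun i j => φ i (f (e j))).det ≠ 0 := by
  constructor
  · intro h
    obtain ⟨v, hv⟩ := exists_linearIndependent_of_le_finrank h
    choose e he using fun j => (v j).2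
    have hli : LinearIndependent K fun j => f (e j) := by
      rw [funext he]
      exact hv.map' (LinearMap.range f).subtype (Submodule.ker_subtype _)
    -- The coordinates of a left inverse L are functionals dual to the vectors f (e j), so the
    -- resulting matrix is the identity.
    obtain ⟨L, hL⟩ := LinearMap.exists_leftInverse_of_injective
      (Fintype.linearCombination K fun j => f (e j))
      (LinearMap.ker_eq_bot.mpr (hli.fintypeLinearCombination_injective))
    refine ⟨e, fun i => LinearMap.proj i ∘ₗ L, ?_⟩
    have h1 : (Matrix.of fun i j => (LinearMap.proj i ∘ₗ L : Module.Dual K F) (f (e j))) = 1 := by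
      ext i j
      have := congrFun (LinearMap.congr_fun hL (Pi.single j 1)) i
      simpa [Matrix.one_apply, Pi.single_apply] using this
    rw [h1, Matrix.det_one]
    exact one_ne_zero
  · rintro ⟨e, φ, h⟩
    have hli : LinearIndependent K fun j => (⟨f (e j), e j, rfl⟩ : LinearMap.range f) := by
      rw [Fintype.linearIndependent_iff]
      intro c hc j
      have hc' : ∑ j, c j • f (e j) = 0 := by simpa using congrArg Subtype.val hc
      refine congrFun (Matrix.eq_zero_of_mulVec_eq_zero h (v := c) ?_) j
      funext i
      have := congrArg (φ i) hc'
      simpa [Matrix.mulVec, dotProduct, mul_comm] using this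
    simpa using hli.fintype_card_le_finrank

/-- The rank is lower semicontinuous. -/
theorem isOpen_le_finrank_range [Finite σ] [Module.Finite K F] (f : (σ → K) →ₗ[K] E →ₗ[K] F)
    (n : ℕ) : IsOpen[zariski K σ] {x | n ≤ Module.finrank K (LinearMap.range (f x))} := by
  let := zariski K σ
  have : {x | n ≤ Module.finrank K (LinearMap.range (f x))} =
      ⋃ (e : Fin n → E) (φ : Fin n → Module.Dual K F),
        {x | (Matrix.of fun i j => φ i (f x (e j))).det ≠ 0} := by
    ext x
    simp only [Set.mem_ofPred_eq, le_finrank_range_iff, Set.mem_iUnion]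
  rw [this]
  refine isOpen_iUnion fun e => isOpen_iUnion fun φ => IsPolynomial.isOpen_ne_zero ?_
  exact IsPolynomial.det fun i j => IsPolynomial.linear (φ i ∘ₗ f.flip (e j))

end Zariski

/-! ### Semicontinuity of top and socle -/

section Semicontinuity

open scoped Topology

variable {K : Type u} [Field K] {V : Type v} [Quiver.{w} V] {d : V → ℕ}

/-- The family of matrices with given entries. -/
def ofEntries : ((Σ a : Arrow V, Fin (d a.2.1) × Fin (d a.1)) → K) →ₗ[K] RepSpace K d where
  toFun y a := Matrix.of fun k l => y ⟨a, k, l⟩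
  map_add' _ _ := rfl
  map_smul' _ _ := rfl

/-- The map `⊕ K ^ {d_j} → K ^ {d_i}` given by the arrows `j → i`. -/
def inMap (i : V) [Fintype (Σ j : V, (j ⟶ i))] :
    RepSpace K d →ₗ[K] (∀ b : Σ j : V, (j ⟶ i), Fin (d b.1) → K) →ₗ[K] (Fin (d i) → K) :=
  LinearMap.mk₂ K (fun x e => ∑ b : Σ j : V, (j ⟶ i), (x ⟨b.1, i, b.2⟩).mulVec (e b))
    (fun x y e => by simp [Matrix.add_mulVec, Finset.sum_add_distrib])
    (fun c x e => by simp [Matrix.smul_mulVec, Finset.smul_sum])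
    (fun x e f => by simp [Matrix.mulVec_add, Finset.sum_add_distrib])
    (fun c x e => by simp [Matrix.mulVec_smul, Finset.smul_sum])

/-- The map `K ^ {d_i} → ∏ K ^ {d_j}` given by the arrows `i → j`. -/
def outMap (i : V) :
    RepSpace K d →ₗ[K] (Fin (d i) → K) →ₗ[K] (∀ b : Σ j : V, (i ⟶ j), Fin (d b.1) → K) :=
  LinearMap.mk₂ K (fun x v b => (x ⟨i, b.1, b.2⟩).mulVec v)
    (fun x y v => by funext b; simp [Matrix.add_mulVec])
    (fun c x v => by funext b; simp [Matrix.smul_mulVec])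
    (fun x v w => by funext b; simp [Matrix.mulVec_add])
    (fun c x v => by funext b; simp [Matrix.mulVec_smul])

theorem range_inMap (x : RepSpace K d) (i : V) [Fintype (Σ j : V, (j ⟶ i))] :
    LinearMap.range (inMap i x) = imSub x i := by
  classical
  refine le_antisymm ?_ (iSup_le fun j => iSup_le fun α => ?_)
  · rintro _ ⟨e, rfl⟩
    exact Submodule.sum_mem _ fun b _ => mulVec_mem_imSub x ⟨b.1, i, b.2⟩ (e b)
  · rintro _ ⟨v, rfl⟩
    refine ⟨Pi.single ⟨j, α⟩ v, ?_⟩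
    rw [inMap, LinearMap.mk₂_apply]
    rw [Finset.sum_eq_single ⟨j, α⟩]
    · simp
    · intro b _ hb
      simp [Pi.single_eq_of_ne hb]
    · simp

theorem ker_outMap (x : RepSpace K d) (i : V) : LinearMap.ker (outMap i x) = kerSub x i := by
  ext v
  rw [mem_kerSub, LinearMap.mem_ker, funext_iff, Sigma.forall]
  rfl

theorem finrank_range_outMap_add (x : RepSpace K d) (i : V) :
    Module.finrank K (LinearMap.range (outMap i x)) + Module.finrank K (kerSub x i) = d i := by
  rw [← ker_outMap, LinearMap.finrank_range_add_finrank_ker, Module.finrank_fin_fun]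

variable [Fintype V] {I : Ideal (PathAlgebra K V)}

theorem isOpen_rep_of_zariski {P : RepSpace K d → Prop}
    (h : IsOpen[zariski K (Σ a : Arrow V, Fin (d a.2.1) × Fin (d a.1))] {y | P (ofEntries y)}) :
    IsOpen {x : Rep I d | P x.1} := by
  let := zariski K (Σ a : Arrow V, Fin (d a.2.1) × Fin (d a.1))
  exact isOpen_induced_iff.mpr ⟨_, h, rfl⟩

variable [∀ i j : V, Finite (i ⟶ j)]

theorem isOpen_le_finrank_imSub (i : V) (n : ℕ) :
    IsOpen {x : Rep I d | n ≤ Module.finrank K (imSub x.1 i)} := by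
  cases nonempty_fintype (Σ j : V, (j ⟶ i))
  refine isOpen_rep_of_zariski (P := fun x => n ≤ Module.finrank K (imSub x i)) ?_
  convert isOpen_le_finrank_range (inMap (K := K) (d := d) i ∘ₗ ofEntries) n using 1
  ext y
  change _ ↔ n ≤ Module.finrank K (LinearMap.range (inMap i (ofEntries y)))
  rw [range_inMap]
  rfl

theorem isOpen_finrank_kerSub_le (i : V) (n : ℕ) :
    IsOpen {x : Rep I d | Module.finrank K (kerSub x.1 i) ≤ n} := by
  refine isOpen_rep_of_zariski (P := fun x => Module.finrank K (kerSub x i) ≤ n) ?_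
  -- By rank-nullity an upper bound n on the kernel is a lower bound `d i - n` on the rank; when n ≥
  -- d i both are vacuous, so truncation is harmless.
  have := isOpen_le_finrank_range (outMap (K := K) (d := d) i ∘ₗ ofEntries) (d i - n)
  convert this using 1
  ext y
  have := finrank_range_outMap_add (ofEntries (K := K) (d := d) y) i
  change _ ≤ n ↔ d i - n ≤ Module.finrank K (LinearMap.range (outMap i (ofEntries y)))
  omega

end Semicontinuity

/-! ### The irreducible strata of `Rep_d(Λ)` -/

section LinearAlgebra

variable {K : Type u} [Field K] {E : Type*} [AddCommGroup E] [Module K E] [Module.Finite K E]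

theorem exists_submodule_finrank_eq {A B : Submodule K E} (hAB : A ≤ B) {n : ℕ}
    (hA : Module.finrank K A ≤ n) (hB : n ≤ Module.finrank K B) :
    ∃ W : Submodule K E, A ≤ W ∧ W ≤ B ∧ Module.finrank K W = n := by
  induction n, hA using Nat.le_induction with
  | base => exact ⟨A, le_rfl, hAB, rfl⟩
  | succ n _ ih =>
    obtain ⟨W, hAW, hWB, hW⟩ := ih (by omega)
    obtain ⟨v, hv, hvW⟩ := SetLike.exists_of_lt (lt_of_le_of_ne hWB (by rintro rfl; omega))
    refine ⟨W ⊔ Submodule.span K {v}, hAW.trans le_sup_left, sup_le hWB ?_, ?_⟩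
    · exact (Submodule.span_singleton_le_iff_mem _ _).mpr hv
    · rw [Submodule.finrank_sup_span_singleton hvW, hW]

/-- Complements of A and B have equal dimension as well, so isomorphisms of the two pairs of
summands can be glued. -/
theorem exists_linearEquiv_of_finrank_eq {A B : Submodule K E}
    (h : Module.finrank K A = Module.finrank K B) :
    ∃ e : E ≃ₗ[K] E, (∀ a ∈ A, e a ∈ B) ∧ ∀ b ∈ B, e.symm b ∈ A := by
  obtain ⟨A', hA⟩ := A.exists_isCompl
  obtain ⟨B', hB⟩ := B.exists_isCompl
  have h' : Module.finrank K A' = Module.finrank K B' := by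
    have h1 := Submodule.finrank_add_eq_of_isCompl hA
    have h2 := Submodule.finrank_add_eq_of_isCompl hB
    omega
  let f := LinearEquiv.ofFinrankEq _ _ h
  refine ⟨(A.prodEquivOfIsCompl A' hA).symm ≪≫ₗ
    (f.prodCongr (LinearEquiv.ofFinrankEq _ _ h')) ≪≫ₗ B.prodEquivOfIsCompl B' hB,
    fun a ha => ?_, fun b hb => ?_⟩
  · have : (A.prodEquivOfIsCompl A' hA).symm a = (⟨a, ha⟩, 0) :=
      (LinearEquiv.symm_apply_eq _).mpr (by simp)
    simp [this]
  · have : (B.prodEquivOfIsCompl B' hB).symm b = (⟨b, hb⟩, 0) :=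
      (LinearEquiv.symm_apply_eq _).mpr (by simp)
    simp [LinearEquiv.trans_symm, this]

/-- The projection of `K ^ n` to the span of the first `r` basis vectors. -/
def coordProj (K : Type u) [Field K] (n r : ℕ) : Matrix (Fin n) (Fin n) K :=
  Matrix.diagonal fun k => if (k : ℕ) < r then 1 else 0

theorem coordProj_mul_self (n r : ℕ) : coordProj K n r * coordProj K n r = coordProj K n r := by
  simp [coordProj]

theorem one_sub_coordProj_mul_coordProj (n r : ℕ) :
    (1 - coordProj K n r) * coordProj K n r = 0 := by
  rw [sub_mul, one_mul, coordProj_mul_self, sub_self]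

theorem rank_coordProj {n r : ℕ} (h : r ≤ n) : (coordProj K n r).rank = r := by
  classical
  rw [coordProj, Matrix.rank_diagonal]
  simp only [ne_eq, ite_eq_right_iff, one_ne_zero, imp_false, not_not]
  rw [Fintype.card_subtype, Fin.card_filter_val_lt, min_eq_right h]

theorem rank_one_sub_coordProj_le {n r : ℕ} (h : r ≤ n) :
    (1 - coordProj K n r).rank ≤ n - r := by
  have hle : LinearMap.range (coordProj K n r).mulVecLin ≤
      LinearMap.ker (1 - coordProj K n r).mulVecLin := by
    rintro _ ⟨v, rfl⟩
    rw [LinearMap.mem_ker, Matrix.mulVecLin_apply, Matrix.mulVecLin_apply, Matrix.mulVec_mulVec,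
      one_sub_coordProj_mul_coordProj, Matrix.zero_mulVec]
  have h1 := Submodule.finrank_mono hle
  have h2 := LinearMap.finrank_range_add_finrank_ker (1 - coordProj K n r).mulVecLin
  have h3 := rank_coordProj (K := K) h
  rw [Module.finrank_fin_fun] at h2
  rw [Matrix.rank] at h3 ⊢
  omega

/-- A subspace of dimension `r` is the image of the span of the first `r` basis vectors under an
invertible matrix. -/
theorem exists_matrix_of_finrank_eq {n : ℕ} (W : Submodule K (Fin n → K)) :
    ∃ g h : Matrix (Fin n) (Fin n) K, g * h = 1 ∧ h * g = 1 ∧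
      (∀ v ∈ W, (coordProj K n (Module.finrank K W)).mulVec (h.mulVec v) = h.mulVec v) ∧
      ∀ v, (g * coordProj K n (Module.finrank K W)).mulVec v ∈ W := by
  set r := Module.finrank K W with hr
  have hrn : r ≤ n := by simpa using Submodule.finrank_le W
  have hrank : Module.finrank K (LinearMap.range (coordProj K n r).mulVecLin) =
      Module.finrank K W := rank_coordProj hrn
  obtain ⟨e, he, he'⟩ := exists_linearEquiv_of_finrank_eq hrank
  refine ⟨LinearMap.toMatrix' e, LinearMap.toMatrix' e.symm, ?_, ?_, ?_, ?_⟩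
  · rw [← LinearMap.toMatrix'_comp]; simp
  · rw [← LinearMap.toMatrix'_comp]; simp
  · intro v hv
    rw [LinearMap.toMatrix'_mulVec]
    obtain ⟨w, hw⟩ := he' v hv
    change _ = (e.symm : (Fin n → K) → Fin n → K) v
    change (coordProj K n r).mulVec (e.symm v) = _
    rw [← hw, Matrix.mulVecLin_apply, Matrix.mulVec_mulVec, coordProj_mul_self]
  · intro v
    rw [← Matrix.mulVec_mulVec, LinearMap.toMatrix'_mulVec]
    exact he _ ⟨v, rfl⟩

end LinearAlgebra

/-! ### Polynomial parametrization of the strata by base changes and block matrices -/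

section NormalForm

variable {K : Type u} [Field K] {V : Type v} [Quiver.{w} V] {d : V → ℕ}

/-- The families of matrices that are, up to scalars and the base change `g`, block matrices which
map the first `r_i` basis vectors to zero and have image in the span of the first `r_i` basis
vectors. -/
def normalForm (r : V → ℕ) (g : ∀ i, Matrix (Fin (d i)) (Fin (d i)) K) (z : RepSpace K d) :
    RepSpace K d := fun a =>
  -- The adjugate replaces the inverse of g: the formula is then polynomial and makes sense for
  -- singular g, so the parameter space is a full affine space. The scalar det g is absorbed in z.
  (g a.2.1 * coordProj K (d a.2.1) (r a.2.1)) *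
    (z a * ((1 - coordProj K (d a.1) (r a.1)) * (g a.1).adjugate))

theorem imSub_le_kerSub_of_mul {x : RepSpace K d}
    (h : ∀ (j i k : V) (α : j ⟶ i) (β : i ⟶ k), x ⟨i, k, β⟩ * x ⟨j, i, α⟩ = 0) (i : V) :
    imSub x i ≤ kerSub x i := by
  refine iSup_le fun j => iSup_le fun α => ?_
  rintro _ ⟨v, rfl⟩
  rw [mem_kerSub]
  intro k β
  rw [Matrix.mulVecLin_apply, Matrix.mulVec_mulVec, h, Matrix.zero_mulVec]

/-- In a product of consecutive arrows the middle factor is (1 - P) adj(g) g P = det(g) (1 - P) P =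
0, whether or not g is invertible. -/
theorem imSub_normalForm_le_kerSub (r : V → ℕ) (g : ∀ i, Matrix (Fin (d i)) (Fin (d i)) K)
    (z : RepSpace K d) (i : V) : imSub (normalForm r g z) i ≤ kerSub (normalForm r g z) i := by
  refine imSub_le_kerSub_of_mul (fun j i k α β => ?_) i
  have h : ((1 - coordProj K (d i) (r i)) * (g i).adjugate) * (g i * coordProj K (d i) (r i)) = 0 := by
    rw [mul_assoc, ← mul_assoc (g i).adjugate, Matrix.adjugate_mul, smul_mul_assoc, one_mul,
      mul_smul_comm, one_sub_coordProj_mul_coordProj, smul_zero]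
  simp only [normalForm]
  rw [Matrix.mul_assoc, Matrix.mul_assoc (z ⟨i, k, β⟩), ← Matrix.mul_assoc _ (g i * _), h]
  simp

theorem finrank_imSub_normalForm_le {r : V → ℕ} (hr : r ≤ d)
    (g : ∀ i, Matrix (Fin (d i)) (Fin (d i)) K) (z : RepSpace K d) (i : V) :
    Module.finrank K (imSub (normalForm r g z) i) ≤ r i := by
  have hle : imSub (normalForm r g z) i ≤
      LinearMap.range (g i * coordProj K (d i) (r i)).mulVecLin := by
    refine iSup_le fun j => iSup_le fun α => ?_
    rintro _ ⟨v, rfl⟩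
    rw [Matrix.mulVecLin_apply, normalForm, ← Matrix.mulVec_mulVec]
    exact ⟨_, rfl⟩
  refine (Submodule.finrank_mono hle).trans ?_
  exact (Matrix.rank_mul_le_right _ _).trans (rank_coordProj (hr i)).le

theorem le_finrank_kerSub_normalForm {r : V → ℕ} (hr : r ≤ d)
    (g : ∀ i, Matrix (Fin (d i)) (Fin (d i)) K) (z : RepSpace K d) (i : V) :
    r i ≤ Module.finrank K (kerSub (normalForm r g z) i) := by
  set A := (1 - coordProj K (d i) (r i)) * (g i).adjugate with hA
  have hle : LinearMap.ker A.mulVecLin ≤ kerSub (normalForm r g z) i := by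
    intro v hv
    rw [mem_kerSub]
    intro j α
    rw [LinearMap.mem_ker, Matrix.mulVecLin_apply] at hv
    rw [normalForm, ← Matrix.mul_assoc, ← Matrix.mulVec_mulVec, hv, Matrix.mulVec_zero]
  refine le_trans ?_ (Submodule.finrank_mono hle)
  have h1 : A.rank ≤ d i - r i :=
    (Matrix.rank_mul_le_left _ _).trans (rank_one_sub_coordProj_le (hr i))
  have h2 := LinearMap.finrank_range_add_finrank_ker A.mulVecLin
  rw [Module.finrank_fin_fun] at h2
  rw [Matrix.rank] at h1
  have h3 : r i ≤ d i := hr i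
  omega

/-- Subspaces W_i of dimension r_i fit between images and kernels. Take g_i invertible, carrying the
coordinate subspace onto W_i, with inverse h_i. Then h x g has the required block shape, and
division by the determinant turns the adjugate into the inverse. -/
theorem exists_normalForm_eq {r : V → ℕ} {x : RepSpace K d} (hx : ∀ i, imSub x i ≤ kerSub x i)
    (him : ∀ i, Module.finrank K (imSub x i) ≤ r i)
    (hker : ∀ i, r i ≤ Module.finrank K (kerSub x i)) :
    ∃ g z, normalForm r g z = x := by
  choose W hiW hWk hW using fun i => exists_submodule_finrank_eq (hx i) (him i) (hker i)
  choose g h hgh hhg hW1 hW2 using fun i => exists_matrix_of_finrank_eq (W i)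
  refine ⟨g, fun a => (g a.1).det⁻¹ • (h a.2.1 * x a * g a.1), funext fun a => ?_⟩
  have h1 : coordProj K (d a.2.1) (r a.2.1) * (h a.2.1 * x a) = h a.2.1 * x a := by
    refine Matrix.ext_of_mulVec_single fun j => ?_
    rw [← Matrix.mulVec_mulVec, ← Matrix.mulVec_mulVec, ← hW a.2.1]
    exact hW1 _ _ (hiW _ (mulVec_mem_imSub x a _))
  have h2 : x a * (g a.1 * coordProj K (d a.1) (r a.1)) = 0 := by
    refine Matrix.ext_of_mulVec_single fun j => ?_
    rw [← Matrix.mulVec_mulVec, ← hW a.1, Matrix.zero_mulVec]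
    exact mem_kerSub.mp (hWk _ (hW2 a.1 _)) a.2.1 a.2.2
  have hdet : (g a.1).det ≠ 0 := fun h0 => by
    have := congrArg Matrix.det (hgh a.1)
    rw [Matrix.det_mul, h0, zero_mul, Matrix.det_one] at this
    exact zero_ne_one this
  have h3 : x a * g a.1 * (1 - coordProj K (d a.1) (r a.1)) = x a * g a.1 := by
    rw [Matrix.mul_sub, Matrix.mul_one, Matrix.mul_assoc, h2, sub_zero]
  calc normalForm r g _ a
      = (g a.1).det⁻¹ • (g a.2.1 * (coordProj K (d a.2.1) (r a.2.1) * (h a.2.1 * x a)) * g a.1 *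
          (1 - coordProj K (d a.1) (r a.1)) * (g a.1).adjugate) := by
        simp only [normalForm, Matrix.smul_mul, Matrix.mul_smul, Matrix.mul_assoc]
    _ = (g a.1).det⁻¹ • (x a * g a.1 * (1 - coordProj K (d a.1) (r a.1)) * (g a.1).adjugate) := by
        rw [h1, ← Matrix.mul_assoc, hgh, Matrix.one_mul]
    _ = x a := by
        rw [h3, Matrix.mul_assoc, Matrix.mul_adjugate, Matrix.mul_smul, Matrix.mul_one, smul_smul,
          inv_mul_cancel₀ hdet, one_smul]

theorem isPolynomial_normalForm {σ : Type*} (r : V → ℕ)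
    {g : (σ → K) → ∀ i, Matrix (Fin (d i)) (Fin (d i)) K} {z : (σ → K) → RepSpace K d}
    (hg : ∀ i k l, IsPolynomial fun y => g y i k l)
    (hz : ∀ a k l, IsPolynomial fun y => z y a k l) (a : Arrow V) (k : Fin (d a.2.1))
    (l : Fin (d a.1)) : IsPolynomial fun y => normalForm r (g y) (z y) a k l :=
  IsPolynomial.matrix_mul
    (A := fun y => g y a.2.1 * coordProj K (d a.2.1) (r a.2.1))
    (B := fun y => z y a * ((1 - coordProj K (d a.1) (r a.1)) * (g y a.1).adjugate))
    (IsPolynomial.matrix_mul (hg _) fun _ _ => IsPolynomial.const _)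
    (IsPolynomial.matrix_mul (hz a) (IsPolynomial.matrix_mul
      (A := fun _ => 1 - coordProj K (d a.1) (r a.1)) (B := fun y => (g y a.1).adjugate)
      (fun _ _ => IsPolynomial.const _) (IsPolynomial.adjugate (hg _)))) k l

variable [Fintype V] {I : Ideal (PathAlgebra K V)} [I.IsTwoSided]

/-- The points of `Rep_d(Λ)` for which there are subspaces of dimension `r_i` between the images
and the kernels of the arrows form an irreducible set. -/
theorem isPreirreducible_setOf_finrank [Infinite K] (hI : IsAdmissible I)
    (hJ : Ring.jacobson (Lam I) ^ 2 = ⊥) {r : V → ℕ} (hr : r ≤ d) :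
    IsPreirreducible {x : Rep I d | (∀ i, Module.finrank K (imSub x.1 i) ≤ r i) ∧
      ∀ i, r i ≤ Module.finrank K (kerSub x.1 i)} := by
  -- The parameters are the entries of all base changes g_i and of all matrices z_a.
  let ρ := (Σ i : V, Fin (d i) × Fin (d i)) ⊕ (Σ a : Arrow V, Fin (d a.2.1) × Fin (d a.1))
  let g : (ρ → K) → ∀ i, Matrix (Fin (d i)) (Fin (d i)) K := fun y i =>
    Matrix.of fun k l => y (Sum.inl ⟨i, k, l⟩)
  let z : (ρ → K) → RepSpace K d := fun y a => Matrix.of fun k l => y (Sum.inr ⟨a, k, l⟩)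
  let ψ : (ρ → K) → Rep I d := fun y => ⟨normalForm r (g y) (z y),
    (mem_rep_iff hI hJ).mpr (imSub_normalForm_le_kerSub r _ _)⟩
  have hS : {x : Rep I d | (∀ i, Module.finrank K (imSub x.1 i) ≤ r i) ∧
      ∀ i, r i ≤ Module.finrank K (kerSub x.1 i)} = ψ '' Set.univ := by
    ext x
    constructor
    · rintro ⟨h1, h2⟩
      obtain ⟨g₀, z₀, h⟩ := exists_normalForm_eq ((mem_rep_iff hI hJ).mp x.2) h1 h2
      exact ⟨Sum.elim (fun c => g₀ c.1 c.2.1 c.2.2) (fun c => z₀ c.1 c.2.1 c.2.2), trivial,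
        Subtype.ext h⟩
    · rintro ⟨y, -, rfl⟩
      exact ⟨finrank_imSub_normalForm_le hr _ _, le_finrank_kerSub_normalForm hr _ _⟩
  rw [hS]
  let := zariski K ρ
  let := zariski K (Σ a : Arrow V, Fin (d a.2.1) × Fin (d a.1))
  refine isPreirreducible_univ_zariski.image ψ (Continuous.continuousOn ?_)
  refine continuous_induced_rng.mpr (IsPolynomial.continuous fun c => ?_)
  have hg : ∀ i k l, IsPolynomial fun y => g y i k l := fun i k l => IsPolynomial.coord _
  have hz : ∀ a k l, IsPolynomial fun y => z y a k l := fun a k l => IsPolynomial.coord _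
  exact isPolynomial_normalForm r hg hz c.1 c.2.1 c.2.2

end NormalForm

/-! ### The components of `Rep_d(Λ)` -/

section Components

variable {K : Type u} [Field K] {V : Type v} [Fintype V] [Quiver.{w} V]
variable {I : Ideal (PathAlgebra K V)} [I.IsTwoSided] {d : V → ℕ}

theorem dimVec_soc_le (hI : IsAdmissible I) (x : Rep I d) : dimVec I (soc I (RepModule x)) ≤ d := by
  intro i
  rw [RepModule.dimVec_soc hI]
  simpa using Submodule.finrank_le (kerSub x.1 i)

theorem isStratified_rep [Infinite K] [∀ i j : V, Finite (i ⟶ j)] (hI : IsAdmissible I)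
    (hJ : Ring.jacobson (Lam I) ^ 2 = ⊥) (d : V → ℕ) :
    IsStratified (fun x : Rep I d => dimVec I (top I (RepModule x)))
      (fun x => dimVec I (soc I (RepModule x))) d where
  isOpen_fst i n := by
    convert isOpen_le_finrank_imSub (I := I) (d := d) i (d i - n) using 1
    ext x
    have := RepModule.dimVec_top_add hI x i
    simp only [Set.mem_ofPred_eq]
    omega
  isOpen_snd i n := by
    convert isOpen_finrank_kerSub_le (I := I) (d := d) i n using 1
    ext x
    simp only [Set.mem_ofPred_eq, RepModule.dimVec_soc hI]
  le x i := Nat.le.intro (RepModule.dimVec_top_add hI x i)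
  le_add x i := by
    have h1 := RepModule.dimVec_top_add hI x i
    have h2 := RepModule.dimVec_soc hI x i
    have h3 := Submodule.finrank_mono ((mem_rep_iff hI hJ).mp x.2 i)
    simp only [Pi.add_apply]
    omega
  isPreirreducible r := by
    by_cases hr : r ≤ d
    -- A bound r on the top corresponds to subspaces of dimension d - r: r ≤ t says dim Im ≤ d - r,
    -- and d ≤ r + b says d - r ≤ dim Ker.
    · convert isPreirreducible_setOf_finrank hI hJ (r := d - r) (fun i => Nat.sub_le _ _) using 1
      ext x
      simp only [Set.mem_ofPred_eq, Pi.le_def, Pi.add_apply, Pi.sub_apply, ← forall_and]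
      refine forall_congr' fun i => ?_
      have h1 := RepModule.dimVec_top_add hI x i
      have h2 := RepModule.dimVec_soc hI x i
      have h3 : r i ≤ d i := hr i
      omega
    · convert isPreirreducible_empty
      refine Set.eq_empty_of_forall_notMem fun x hx => hr (hx.1.trans fun i => ?_)
      exact Nat.le.intro (RepModule.dimVec_top_add hI x i)

instance {M : Type*} [AddCommGroup M] [Module K M] [Module (Lam I) M] [IsScalarTower K (Lam I) M]
    [Module.Finite K M] : Module.Finite K (soc I M) :=
  inferInstanceAs (Module.Finite K ((soc I M).restrictScalars K))

theorem isSemisimpleModule_of_arrowKer {M : Type*} [AddCommGroup M] [Module K M] [Module (Lam I) M]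
    [IsScalarTower K (Lam I) M] (hI : IsAdmissible I) (hM : arrowKer I M = ⊤) :
    IsSemisimpleModule (Lam I) M := by
  refine IsSemisimpleModule.of_sSup_simples_eq_top (eq_top_iff.mpr fun m _ => ?_)
  exact (mem_soc_iff hI).mpr (hM.ge Submodule.mem_top)

/-- Tops are killed by the arrows, and so is T; such modules are isomorphic as soon as their
dimension vectors agree. -/
theorem repTop_eq (hI : IsAdmissible I) (d : V → ℕ) (T : Type w') [AddCommGroup T] [Module K T]
    [Module (Lam I) T] [IsScalarTower K (Lam I) T] [Module.Finite K T] (hT : arrowKer I T = ⊤) :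
    RepTop I d T = {x | dimVec I (top I (RepModule x)) = dimVec I T} := by
  ext x
  constructor
  · rintro ⟨e⟩
    exact dimVec_congr e
  · intro h
    exact nonempty_equiv_of_dimVec_eq (arrowKer_top hI) hT h

/-- This passes from all modules to points of the variety, so that minimality can be tested on the
values of (t, b). -/
theorem topSoc_eq_range (hI : IsAdmissible I) (d : V → ℕ) :
    TopSoc I d = Set.range fun x : Rep I d => topSocPair I (RepModule x) := by
  ext p
  constructor
  · rintro ⟨M, _, _, _, _, hM, rfl⟩
    obtain ⟨x, ⟨e⟩⟩ := exists_equiv_repModule hM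
    exact ⟨x, (topSocPair_congr hI e).symm⟩
  · rintro ⟨x, rfl⟩
    exact ⟨RepModule x, inferInstance, inferInstance, inferInstance, inferInstance,
      RepModule.hasDimVec x, rfl⟩

theorem topSoc_finite (hI : IsAdmissible I) (d : V → ℕ) : (TopSoc I d).Finite := by
  classical
  refine (Set.finite_Icc (0 : (V → ℕ) × (V → ℕ)) (d, d)).subset ?_
  rw [topSoc_eq_range hI]
  rintro _ ⟨x, rfl⟩
  refine ⟨⟨fun _ => Nat.zero_le _, fun _ => Nat.zero_le _⟩, fun i => ?_, dimVec_soc_le hI x⟩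
  have := RepModule.dimVec_top_add hI x i
  simp only [topSocPair]
  omega

end Components

end RadSq

end

/-! ### The correspondence between minimal pairs and components, generic tops and generic socles -/

open RadSq in
theorem corollary3p7 {K : Type u} [Field K] [IsAlgClosed K]
    {V : Type v} [Fintype V] [Quiver.{w} V] [∀ i j : V, Finite (i ⟶ j)]
    (I : Ideal (PathAlgebra K V)) [I.IsTwoSided] (hI : IsAdmissible I)
    (hJ : Ring.jacobson (Lam I) ^ 2 = ⊥) (d : V → ℕ) :
    -- the components of the form `closure (Rep_d^T)`
    (∀ (T : Type (max u v)) [AddCommGroup T] [Module K T] [Module (Lam I) T]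
        [IsScalarTower K (Lam I) T] [Module.Finite K T] [IsSemisimpleModule (Lam I) T],
      closure (RepTop I d T) ∈ irreducibleComponents (Rep I d) ↔
        ∃ (M : Type (max u v)) (_ : AddCommGroup M) (_ : Module K M) (_ : Module (Lam I) M)
          (_ : IsScalarTower K (Lam I) M),
          Nonempty (top I M ≃ₗ[Lam I] T) ∧ HasDimVec I M d ∧
            Minimal (· ∈ TopSoc I d) (topSocPair I M)) ∧
    -- all components, all generic tops and all generic socles
    (TopSoc I d).Finite ∧
    ∀ (m : ℕ) (M : Fin m → Type (max u v)) [∀ j, AddCommGroup (M j)] [∀ j, Module K (M j)]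
      [∀ j, Module (Lam I) (M j)] [∀ j, IsScalarTower K (Lam I) (M j)],
      (∀ j, HasDimVec I (M j) d) →
      Function.Injective (fun j => topSocPair I (M j)) →
      Set.range (fun j => topSocPair I (M j)) = {p | Minimal (· ∈ TopSoc I d) p} →
      (irreducibleComponents (Rep I d)).ncard = m ∧
      Function.Injective (fun j => closure (RepTop I d (top I (M j)))) ∧
      irreducibleComponents (Rep I d) = Set.range (fun j => closure (RepTop I d (top I (M j)))) ∧
      (∀ j, IsGenericSocleOn (closure (RepTop I d (top I (M j)))) (soc I (M j))) ∧
      (∀ (T : Type (max u v)) [AddCommGroup T] [Module K T] [Module (Lam I) T]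
          [IsScalarTower K (Lam I) T] [Module.Finite K T] [IsSemisimpleModule (Lam I) T],
        IsGenericTop I d T ↔ ∃ j, Nonempty (top I (M j) ≃ₗ[Lam I] T)) ∧
      (∀ (U : Type (max u v)) [AddCommGroup U] [Module K U] [Module (Lam I) U]
          [IsScalarTower K (Lam I) U] [Module.Finite K U] [IsSemisimpleModule (Lam I) U],
        IsGenericSocle I d U ↔ ∃ j, Nonempty (soc I (M j) ≃ₗ[Lam I] U)) := by
  have : Infinite K := IsAlgClosed.instInfinite
  have hst := isStratified_rep hI hJ d
  have hrange : TopSoc I d = Set.range fun x : Rep I d =>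
      (dimVec I (top I (RepModule x)), dimVec I (soc I (RepModule x))) := topSoc_eq_range hI d
  have part1 : ∀ (T : Type (max u v)) [AddCommGroup T] [Module K T] [Module (Lam I) T]
        [IsScalarTower K (Lam I) T] [Module.Finite K T] [IsSemisimpleModule (Lam I) T],
      closure (RepTop I d T) ∈ irreducibleComponents (Rep I d) ↔
        ∃ (M : Type (max u v)) (_ : AddCommGroup M) (_ : Module K M) (_ : Module (Lam I) M)
          (_ : IsScalarTower K (Lam I) M),
          Nonempty (top I M ≃ₗ[Lam I] T) ∧ HasDimVec I M d ∧
            Minimal (· ∈ TopSoc I d) (topSocPair I M) := by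
    intro T _ _ _ _ _ _
    have hT := arrowKer_eq_top_of_isSemisimpleModule (M := T) hI
    rw [repTop_eq hI d T hT, hst.closure_level_mem_irreducibleComponents_iff, hrange]
    constructor
    · rintro ⟨x, hx, hmin⟩
      exact ⟨RepModule x, inferInstance, inferInstance, inferInstance, inferInstance,
        nonempty_equiv_of_dimVec_eq (arrowKer_top hI) hT hx, RepModule.hasDimVec x, hmin⟩
    · rintro ⟨M, _, _, _, _, ⟨e⟩, hM, hmin⟩
      obtain ⟨x, ⟨f⟩⟩ := exists_equiv_repModule hM
      rw [topSocPair_congr hI f] at hmin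
      exact ⟨x, (dimVec_congr (topCongr f)).symm.trans (dimVec_congr e), hmin⟩
  refine ⟨part1, topSoc_finite hI d, ?_⟩
  intro m M _ _ _ _ hM hinj hmin
  have hfin : ∀ j, Module.Finite K (M j) := fun j => (hM j).1
  choose x e using fun j => exists_equiv_repModule (hM j)
  have hpair : ∀ j, topSocPair I (M j) = topSocPair I (RepModule (x j)) := fun j =>
    topSocPair_congr hI (e j).some
  have hxmin : ∀ j, Minimal (· ∈ Set.range fun y : Rep I d =>
      (dimVec I (top I (RepModule y)), dimVec I (soc I (RepModule y))))
      (dimVec I (top I (RepModule (x j))), dimVec I (soc I (RepModule (x j)))) := by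
    intro j
    have h : topSocPair I (M j) ∈ {p | Minimal (· ∈ TopSoc I d) p} := hmin ▸ ⟨j, rfl⟩
    rw [hpair, hrange] at h
    exact h
  have hRep : ∀ j, RepTop I d (top I (M j)) =
      {y | dimVec I (top I (RepModule y)) = dimVec I (top I (RepModule (x j)))} := by
    intro j
    rw [repTop_eq hI d _ (arrowKer_top hI), dimVec_congr (topCongr (e j).some)]
  have hinjC : Function.Injective fun j => closure (RepTop I d (top I (M j))) := by
    intro j k hjk
    simp only [hRep] at hjk
    refine hinj ?_
    simp only [hpair]
    exact hst.eq_of_closure_level_eq (hxmin j) (hxmin k) hjk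
  have hcomp : irreducibleComponents (Rep I d) =
      Set.range fun j => closure (RepTop I d (top I (M j))) := by
    ext C
    constructor
    · intro hC
      obtain ⟨y, hy, rfl⟩ := hst.exists_minimal_of_mem_irreducibleComponents hC
      rw [← hrange] at hy
      obtain ⟨j, hj⟩ := hmin.ge hy
      refine ⟨j, ?_⟩
      have h1 : dimVec I (top I (RepModule (x j))) = dimVec I (top I (RepModule y)) :=
        congrArg Prod.fst ((hpair j).symm.trans hj)
      simp only [hRep, h1]
    · rintro ⟨j, rfl⟩
      simp only [hRep]
      exact hst.closure_level_mem_irreducibleComponents (hxmin j)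
  have hsoc : ∀ j, IsGenericSocleOn (closure (RepTop I d (top I (M j)))) (soc I (M j)) := by
    intro j
    obtain ⟨O, hO, hdense, hOx⟩ := hst.exists_isOpen_snd_eq (hxmin j)
    refine ⟨O, hO, by rwa [hRep], fun y hy => ?_⟩
    -- On the dense open set the socle has the dimension vector of the socle of M j, and socles are
    -- determined by it.
    refine nonempty_equiv_of_dimVec_eq (arrowKer_soc hI) (arrowKer_soc hI) ((hOx y hy.2).trans ?_)
    exact (dimVec_congr (socCongr hI (e j).some)).symm
  have htop : ∀ (T : Type (max u v)) [AddCommGroup T] [Module K T] [Module (Lam I) T]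
      [IsScalarTower K (Lam I) T] [Module.Finite K T] [IsSemisimpleModule (Lam I) T],
      IsGenericTop I d T ↔ ∃ j, Nonempty (top I (M j) ≃ₗ[Lam I] T) := by
    intro T _ _ _ _ _ _
    have hT := arrowKer_eq_top_of_isSemisimpleModule (M := T) hI
    constructor
    · intro h
      obtain ⟨N, _, _, _, _, ⟨f⟩, -, hNmin⟩ := (part1 T).mp h
      obtain ⟨j, hj⟩ := hmin.ge hNmin
      exact ⟨j, nonempty_equiv_of_dimVec_eq (arrowKer_top hI) hT
        ((congrArg Prod.fst hj).trans (dimVec_congr f))⟩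
    · rintro ⟨j, ⟨f⟩⟩
      rw [IsGenericTop, repTop_eq hI d T hT, ← dimVec_congr f,
        ← repTop_eq hI d _ (arrowKer_top hI), hcomp]
      exact ⟨j, rfl⟩
  refine ⟨?_, hinjC, hcomp, hsoc, htop, ?_⟩
  · rw [hcomp, ← Set.image_univ, Set.ncard_image_of_injective _ hinjC, Set.ncard_univ,
      Nat.card_fin]
  · intro U _ _ _ _ _ _
    constructor
    · rintro ⟨T, _, _, _, _, _, _, hT, O, hO, hdense, hOU⟩
      obtain ⟨j, ⟨f⟩⟩ := (htop T).mp hT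
      have hTM : RepTop I d T = RepTop I d (top I (M j)) := by
        ext y
        exact ⟨fun ⟨g⟩ => ⟨g.trans f.symm⟩, fun ⟨g⟩ => ⟨g.trans f⟩⟩
      rw [IsGenericTop] at hT
      rw [hTM] at hT hdense hOU
      obtain ⟨O', hO', hdense', hOM⟩ := hsoc j
      have hne := hT.1.nonempty
      -- The dense open sets for U and for the socle of M j meet in the irreducible closure; at a
      -- common point y both modules are the socle of M(y).
      obtain ⟨y, hyC, hyO, hyO'⟩ := hT.1.isPreirreducible O O' hO hO'
        (closure_nonempty_iff.mp (hne.mono hdense)) (closure_nonempty_iff.mp (hne.mono hdense'))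
      exact ⟨j, ⟨(hOM y ⟨hyC, hyO'⟩).some.symm.trans (hOU y ⟨hyC, hyO⟩).some⟩⟩
    · rintro ⟨j, ⟨f⟩⟩
      have hss := isSemisimpleModule_of_arrowKer hI (arrowKer_top (M := M j) hI)
      refine ⟨top I (M j), inferInstance, inferInstance, inferInstance, inferInstance,
        inferInstance, hss, ?_, ?_⟩
      · rw [IsGenericTop, hcomp]
        exact ⟨j, rfl⟩
      · obtain ⟨O, hO, hdense, hOM⟩ := hsoc j
        exact ⟨O, hO, hdense, fun y hy => ⟨(hOM y hy).some.trans f⟩⟩
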